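/- Let $m,n$ be square-free integers with $m\equiv 3\pmod 4$ and $n\equiv 2\pmod 4$, and let $L=\mathbb{Q}(\sqrt m,\sqrt n)$ be totally real. Let $G=\mathrm{Gal}(L/\mathbb{Q})=\{1,\sigma,\tau,\sigma\tau\}$, where $\sigma(\sqrt m)=-\sqrt m$, $\sigma(\sqrt n)=\sqrt n$, $\tau(\sqrt m)=\sqrt m$, $\tau(\sqrt n)=-\sqrt n$, and let $\lambda(g)\in\mathrm{Perm}(G)$ denote left translation by $g\in G$. Let $$N_1=\langle \lambda(\tau),(1,\sigma\tau,\tau,\sigma)\rangle,\quad N_2=\langle \lambda(\sigma),(1,\sigma\tau,\sigma,\tau)\rangle,\quad N_3=\langle \lambda(\sigma\tau),(1,\tau,\sigma\tau,\sigma)\rangle$$ in $\mathrm{Perm}(G)$. For $i\in\{1,2,3\}$ let $H_i=L[N_i]^G$ be the fixed points of the action of $G$ on the group algebra $L[N_i]$ by $g\cdot(c\,\eta)=g(c)\,\lambda(g)\eta\lambda(g)^{-1}$; it acts on $L$ by $\bigl(\sum_{\eta}c_\eta\,\eta\bigr)\cdot x=\sum_{\eta}c_\eta\,\bigl(\eta^{-1}(1)\bigr)(x)$.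 These are the three non-classical Hopf–Galois structures on $L/\mathbb{Q}$. Let $\mathfrak{A}_{H_i}=\{h\in H_i : h\cdot\mathcal{O}_L\subseteq\mathcal{O}_L\}$ be the associated order of $\mathcal{O}_L$ in $H_i$. Then $\mathcal{O}_L$ is free as an $\mathfrak{A}_{H_i}$-module for all $i\in\{1,2,3\}$ if and only if $L=\mathbb{Q}(\sqrt m,\sqrt 2)$ (that is, $L$ contains a square root of $2$ which together with $\sqrt m$ generates $L$). -/

import Mathlib

open scoped NumberField

noncomputable section

namespace HopfGalois

/-! ### The Hopf algebra `L[N]^G` attached to a subgroup `N` of `Perm G`, and its action on `L` -/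

section Descent

variable {K L : Type*} [Field K] [Field L] [Algebra K L]

/-- The action of `g ∈ G = Gal(L/K)` on the group algebra `L[Perm G]`: by the Galois action on
the coefficients in `L`, and by conjugation by the left translation `lambda(g)` on permutations,
that is `c η ↦ g(c) (lambda(g) η lambda(g)⁻¹)`. -/
def galAct (g : L ≃ₐ[K] L) :
    MonoidAlgebra L (Equiv.Perm (L ≃ₐ[K] L)) →ₐ[K] MonoidAlgebra L (Equiv.Perm (L ≃ₐ[K] L)) :=
  (MonoidAlgebra.mapDomainAlgHom K L
    (MulAut.conj (Equiv.mulLeft g : Equiv.Perm (L ≃ₐ[K] L))).toMonoidHom).comp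
  (MonoidAlgebra.mapAlgHom (Equiv.Perm (L ≃ₐ[K] L)) (g : L →ₐ[K] L))

/-- `H = L[N]^G`: the elements of `L[N]` (seen inside `L[Perm G]`) that are fixed by `G`.
For `N` regular and normalized by the left translations, this is the Hopf algebra of the
Hopf-Galois structure on `L/K` given by `N`. -/
def hopfAlg (N : Subgroup (Equiv.Perm (L ≃ₐ[K] L))) :
    Subalgebra K (MonoidAlgebra L (Equiv.Perm (L ≃ₐ[K] L))) :=
  (MonoidAlgebra.mapDomainAlgHom K L N.subtype).range ⊓
    ⨅ g : L ≃ₐ[K] L, AlgHom.equalizer (galAct g) (AlgHom.id K _)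

/-- The endomorphism `x ↦ ∑ η, c η * (η⁻¹ g)(x)` of `L` attached to `∑ η, c η • η`. -/
def actAt (g : L ≃ₐ[K] L) (h : MonoidAlgebra L (Equiv.Perm (L ≃ₐ[K] L))) : Module.End K L :=
  h.coeff.sum fun η c => c • (η⁻¹ g).toLinearMap

/-- The action of `h = ∑ η, c η • η` on `L`: `h · x = ∑ η, c η * (η⁻¹ 1)(x)`. -/
def act (h : MonoidAlgebra L (Equiv.Perm (L ≃ₐ[K] L))) : Module.End K L :=
  actAt 1 h

theorem actAt_single (g : L ≃ₐ[K] L) (η : Equiv.Perm (L ≃ₐ[K] L)) (c : L) :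
    actAt g (MonoidAlgebra.single η c) = c • (η⁻¹ g).toLinearMap := by
  unfold actAt
  rw [MonoidAlgebra.coeff_single]
  exact Finsupp.sum_single_index (zero_smul _ _)

theorem actAt_zero (g : L ≃ₐ[K] L) : actAt g 0 = 0 := by
  unfold actAt
  rw [MonoidAlgebra.coeff_zero, Finsupp.sum_zero_index]

theorem actAt_add (g : L ≃ₐ[K] L) (x y : MonoidAlgebra L (Equiv.Perm (L ≃ₐ[K] L))) :
    actAt g (x + y) = actAt g x + actAt g y := by
  unfold actAt
  rw [MonoidAlgebra.coeff_add]
  exact Finsupp.sum_add_index' (fun _ => zero_smul _ _) (fun _ _ _ => add_smul _ _ _)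

theorem galAct_single (g : L ≃ₐ[K] L) (η : Equiv.Perm (L ≃ₐ[K] L)) (c : L) :
    galAct g (MonoidAlgebra.single η c) =
      MonoidAlgebra.single (Equiv.mulLeft g * η * (Equiv.mulLeft g)⁻¹) (g c) := by
  simp [galAct]

theorem comp_act (g : L ≃ₐ[K] L) (y : MonoidAlgebra L (Equiv.Perm (L ≃ₐ[K] L))) :
    g.toLinearMap * act y = actAt g (galAct g y) := by
  induction y using MonoidAlgebra.induction_linear with
  | zero => simp [act, actAt_zero]
  | add a b ha hb =>
    rw [map_add, actAt_add, ← ha, ← hb, ← mul_add]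
    unfold act
    rw [actAt_add]
  | single η c =>
    rw [galAct_single, act, actAt_single, actAt_single]
    ext x
    simp [mul_assoc]

theorem act_single_mul (η : Equiv.Perm (L ≃ₐ[K] L)) (c : L)
    (y : MonoidAlgebra L (Equiv.Perm (L ≃ₐ[K] L))) :
    act (MonoidAlgebra.single η c * y) = c • actAt (η⁻¹ 1) y := by
  unfold act
  induction y using MonoidAlgebra.induction_linear with
  | zero => simp [actAt_zero]
  | add a b ha hb => rw [mul_add, actAt_add, ha, hb, actAt_add, smul_add]
  | single θ e =>
    rw [MonoidAlgebra.single_mul_single, actAt_single, actAt_single, smul_smul]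
    simp

theorem act_mul (x y : MonoidAlgebra L (Equiv.Perm (L ≃ₐ[K] L)))
    (hy : ∀ g : L ≃ₐ[K] L, galAct g y = y) : act (x * y) = act x * act y := by
  induction x using MonoidAlgebra.induction_linear with
  | zero => simp [act, actAt_zero]
  | add a b ha hb =>
    rw [add_mul]
    unfold act at *
    rw [actAt_add, actAt_add, ha, hb, add_mul]
  | single η c =>
    have h := comp_act (η⁻¹ 1) y
    rw [hy] at h
    rw [act_single_mul, ← h]
    conv_rhs => rw [act, actAt_single]
    rw [smul_mul_assoc]

theorem act_one : act (1 : MonoidAlgebra L (Equiv.Perm (L ≃ₐ[K] L))) = 1 := by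
  rw [MonoidAlgebra.one_def, act, actAt_single]
  ext x
  simp

theorem galAct_eq_of_mem {N : Subgroup (Equiv.Perm (L ≃ₐ[K] L))}
    {y : MonoidAlgebra L (Equiv.Perm (L ≃ₐ[K] L))} (hy : y ∈ hopfAlg N) (g : L ≃ₐ[K] L) :
    galAct g y = y := by
  have h := (Algebra.mem_inf.1 hy).2
  rw [Algebra.mem_iInf] at h
  exact h g

/-- The representation `h ↦ (x ↦ h · x)` of `L[N]^G` on `L`. -/
def rep (N : Subgroup (Equiv.Perm (L ≃ₐ[K] L))) : hopfAlg N →+* Module.End K L where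
  toFun h := act (h : MonoidAlgebra L (Equiv.Perm (L ≃ₐ[K] L)))
  map_zero' := by simp [act, actAt_zero]
  map_one' := by simp [act_one]
  map_add' x y := by simp [act, actAt_add]
  map_mul' x y := by
    rw [Subalgebra.coe_mul]
    exact act_mul _ _ fun g => galAct_eq_of_mem y.2 g

end Descent

/-! ### The associated order and freeness of the ring of integers -/

section AssociatedOrder

variable {L : Type*} [Field L] [NumberField L]

/-- The associated order `{h ∈ H | h · 𝓞 L ⊆ 𝓞 L}` in `H = L[N]^G`, where `G = Gal(L/ℚ)`. -/
def assocOrder (N : Subgroup (Equiv.Perm (L ≃ₐ[ℚ] L))) : Subring (hopfAlg N) where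
  carrier := {h | ∀ x : 𝓞 L, IsIntegral ℤ (rep N h (x : L))}
  zero_mem' x := by simpa using isIntegral_zero
  one_mem' x := by simpa using x.isIntegral_coe
  add_mem' ha hb x := by simpa using (ha x).add (hb x)
  neg_mem' ha x := by simpa using (ha x).neg
  mul_mem' {a b} ha hb x := by
    have h : IsIntegral ℤ (rep N a (rep N b (x : L))) := ha ⟨rep N b (x : L), hb x⟩
    simpa using h

/-- The action of the associated order on `𝓞 L`. -/
def assocOrderRep (N : Subgroup (Equiv.Perm (L ≃ₐ[ℚ] L))) :
    assocOrder N →+* AddMonoid.End (𝓞 L) where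
  toFun h :=
    { toFun := fun x => ⟨rep N h.1 (x : L), h.2 x⟩
      map_zero' := NumberField.RingOfIntegers.ext (map_zero (rep N h.1))
      map_add' := fun x y =>
        NumberField.RingOfIntegers.ext (map_add (rep N h.1) (x : L) (y : L)) }
  map_zero' := AddMonoidHom.ext fun x => NumberField.RingOfIntegers.ext
    (LinearMap.congr_fun (map_zero (rep N)) (x : L))
  map_one' := AddMonoidHom.ext fun x => NumberField.RingOfIntegers.ext
    (LinearMap.congr_fun (map_one (rep N)) (x : L))
  map_add' h h' := AddMonoidHom.ext fun x => NumberField.RingOfIntegers.ext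
    (LinearMap.congr_fun (map_add (rep N) h.1 h'.1) (x : L))
  map_mul' h h' := AddMonoidHom.ext fun x => NumberField.RingOfIntegers.ext
    (LinearMap.congr_fun (map_mul (rep N) h.1 h'.1) (x : L))

/-- `𝓞 L` is free as a module over the associated order in `H = L[N]^G`. -/
def IsFreeOverAssocOrder (N : Subgroup (Equiv.Perm (L ≃ₐ[ℚ] L))) : Prop :=
  letI : Module (assocOrder N) (𝓞 L) := Module.compHom (𝓞 L) (assocOrderRep N)
  Module.Free (assocOrder N) (𝓞 L)

end AssociatedOrder

/-! ### The non-classical structures of an elementary abelian quartic extension -/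

section Permutations

open scoped Classical in
/-- For `G = {1, σ, τ, στ}` elementary abelian and `T = ⟨τ⟩`, the subgroup `⟨μ, η⟩` of `Perm G`,
where `μ` is the translation by `τ` and `η` is the four-cycle `(1, στ, τ, σ)`, that is
`η (σ ^ k * τ ^ l) = σ ^ (k - 1) * τ ^ (l + k - 1)`. -/
def permGroup {G : Type*} [Group G] (σ τ : G) : Subgroup (Equiv.Perm G) :=
  Subgroup.closure {Equiv.mulLeft τ, [1, σ * τ, τ, σ].formPerm}

/-- The subgroups `N₁, N₂, N₃` of `Perm G` that define the three non-classical Hopf-Galois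
structures `Hᵢ = L[Nᵢ]^G`; they belong to `T₁ = ⟨τ⟩`, `T₂ = ⟨σ⟩`, `T₃ = ⟨στ⟩`. -/
def nonClassical {G : Type*} [Group G] (σ τ : G) : Fin 3 → Subgroup (Equiv.Perm G) :=
  ![permGroup σ τ, permGroup τ σ, permGroup σ (σ * τ)]

end Permutations

end HopfGalois

end

/-! Put `d = gcd(m, n)`, `m = d m₁`, `n = d n₁`, and let `a`, `b`, `c = a b / d` be square roots of
`d m₁`, `d n₁`, `m₁ n₁`. Each `Nᵢ` is cyclic of order four, generated by a cycle `η` with `η² =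
λ(t)`; `λ(s)` inverts `η` and `λ(t)` centralises it. So `L[Nᵢ]^G` has four rational parameters: its
elements act as `p` on `1`, as `q` on `α` (the square root fixed by `t`), and as `r + w J` on the
plane of the two other square roots, where `J² = -α²` (`exists_hopfElt`, `act_hopfElt`).

This algebra is commutative and acts faithfully. The sum of `Nᵢ` acts as the trace, which sends `𝓞
L` into `ℤ`, so a free `𝓞 L` has rank one. Freeness thus means that one integral `x` reaches every
integral `y` by an operator preserving `𝓞 L` (`isFree_iff`). With the integral basis `1, a, (b +
c)/2, c` (`isIntegral_iff`) this is a question about an explicit lattice in `ℚ⁴`.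

Necessity comes from norm forms. On its plane, `r + w J` multiplies a definite quadratic form by its
determinant, an integer when the lattice is preserved. The value `Q` of the form at a generator
therefore divides its value at every lattice point. For `N₁`, `Q` divides the coprime `d` and `m₁`,
so `d X² + m₁ Y² = 4` with `X ≡ Y` mod `2`, whence `d = 1` or `m₁ = 1`. For `N₂`, `Q` divides the
coprime `2d` and `n₁/2`, whence `n₁ = 2`. Conversely, explicit generators exist for all three
structures under these conditions.

Finally, a square root of `2` in `L` is an eigenvector of `σ` and `τ`, hence a rational multiple of
`1`, `a`, `b` or `c`. This happens exactly when `n₁ = 2` and `d = 1` or `m₁ = 1`, the root being `b`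
or `c` up to sign. -/

noncomputable section

namespace HopfGalois

/-! ### Biquadratic extensions of `ℚ` -/

/-- The field `L` has the basis `1, α, β, α * β` over `ℚ`, where `α ^ 2 = M` and `β ^ 2 = P` are
rational, and `s`, `t` are the automorphisms with `s α = -α`, `s β = β`, `t α = α`, `t β = -β`. -/
structure IsBiquadratic {L : Type*} [Field L] [Algebra ℚ L] (s t : L ≃ₐ[ℚ] L) (α β : L)
    (M P : ℚ) : Prop where
  s_left : s α = -α
  s_right : s β = β
  t_left : t α = α
  t_right : t β = -β
  left_ne_zero : α ≠ 0
  right_ne_zero : β ≠ 0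
  left_sq : α ^ 2 = M
  right_sq : β ^ 2 = P
  exists_coord : ∀ x : L, ∃ y₀ y₁ y₂ y₃ : ℚ, x = y₀ + y₁ * α + y₂ * β + y₃ * (α * β)

namespace IsBiquadratic

variable {L : Type*} [Field L] [Algebra ℚ L] {s t : L ≃ₐ[ℚ] L} {α β : L} {M P : ℚ}

theorem coord_eq_zero (h : IsBiquadratic s t α β M P) {y₀ y₁ y₂ y₃ : ℚ}
    (hy : (y₀ : L) + y₁ * α + y₂ * β + y₃ * (α * β) = 0) :
    y₀ = 0 ∧ y₁ = 0 ∧ y₂ = 0 ∧ y₃ = 0 := by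
  have : CharZero L := algebraRat.charZero L
  have h1 := congrArg s hy
  have h2 := congrArg t hy
  have h3 := congrArg t h1
  simp only [map_add, map_mul, map_ratCast, map_zero, map_neg, h.s_left, h.s_right, h.t_left,
    h.t_right] at h1 h2 h3
  -- Averaging the four conjugates against the characters of the Galois group isolates each term.
  have e0 : (y₀ : L) = 0 := by linear_combination (1 / 4 : L) * (hy + h1 + h2 + h3)
  have e1 : (y₁ : L) * α = 0 := by linear_combination (1 / 4 : L) * (hy - h1 + h2 - h3)
  have e2 : (y₂ : L) * β = 0 := by linear_combination (1 / 4 : L) * (hy + h1 - h2 - h3)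
  have e3 : (y₃ : L) * (α * β) = 0 := by linear_combination (1 / 4 : L) * (hy - h1 - h2 + h3)
  have := h.left_ne_zero
  have := h.right_ne_zero
  simp_all

theorem coord_inj (h : IsBiquadratic s t α β M P) {y₀ y₁ y₂ y₃ z₀ z₁ z₂ z₃ : ℚ}
    (hy : (y₀ : L) + y₁ * α + y₂ * β + y₃ * (α * β) = z₀ + z₁ * α + z₂ * β + z₃ * (α * β)) :
    y₀ = z₀ ∧ y₁ = z₁ ∧ y₂ = z₂ ∧ y₃ = z₃ := by
  have : CharZero L := algebraRat.charZero L
  have := h.coord_eq_zero (y₀ := y₀ - z₀) (y₁ := y₁ - z₁) (y₂ := y₂ - z₂) (y₃ := y₃ - z₃)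
    (by push_cast; linear_combination hy)
  simpa only [sub_eq_zero] using this

theorem algEquiv_ext (h : IsBiquadratic s t α β M P) {g g' : L ≃ₐ[ℚ] L} (hα : g α = g' α)
    (hβ : g β = g' β) : g = g' := by
  ext x
  obtain ⟨y₀, y₁, y₂, y₃, rfl⟩ := h.exists_coord x
  simp [hα, hβ]

theorem left_ne_neg (h : IsBiquadratic s t α β M P) : α ≠ -α := by
  have : CharZero L := algebraRat.charZero L
  exact fun h' => h.left_ne_zero (self_eq_neg.1 h')

theorem right_ne_neg (h : IsBiquadratic s t α β M P) : β ≠ -β := by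
  have : CharZero L := algebraRat.charZero L
  exact fun h' => h.right_ne_zero (self_eq_neg.1 h')

theorem s_ne_one (h : IsBiquadratic s t α β M P) : s ≠ 1 := by
  rintro rfl
  exact h.left_ne_neg h.s_left

theorem t_ne_one (h : IsBiquadratic s t α β M P) : t ≠ 1 := by
  rintro rfl
  exact h.right_ne_neg h.t_right

theorem s_ne_t (h : IsBiquadratic s t α β M P) : s ≠ t := by
  rintro rfl
  exact h.left_ne_neg (h.t_left.symm.trans h.s_left)

theorem s_mul_s (h : IsBiquadratic s t α β M P) : s * s = 1 :=
  h.algEquiv_ext (by simp [h.s_left]) (by simp [h.s_right])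

theorem t_mul_t (h : IsBiquadratic s t α β M P) : t * t = 1 :=
  h.algEquiv_ext (by simp [h.t_left]) (by simp [h.t_right])

theorem t_mul_s (h : IsBiquadratic s t α β M P) : t * s = s * t :=
  h.algEquiv_ext (by simp [h.t_left, h.s_left]) (by simp [h.t_right, h.s_right])

theorem eq_or (h : IsBiquadratic s t α β M P) (g : L ≃ₐ[ℚ] L) :
    g = 1 ∨ g = s ∨ g = t ∨ g = s * t := by
  have hα : g α = α ∨ g α = -α := by
    rw [← sq_eq_sq_iff_eq_or_eq_neg, ← map_pow, h.left_sq, map_ratCast]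
  have hβ : g β = β ∨ g β = -β := by
    rw [← sq_eq_sq_iff_eq_or_eq_neg, ← map_pow, h.right_sq, map_ratCast]
  rcases hα with hα | hα <;> rcases hβ with hβ | hβ
  · exact Or.inl (h.algEquiv_ext (by simp [hα]) (by simp [hβ]))
  · exact Or.inr (Or.inr (Or.inl (h.algEquiv_ext (by simp [hα, h.t_left])
      (by simp [hβ, h.t_right]))))
  · exact Or.inr (Or.inl (h.algEquiv_ext (by simp [hα, h.s_left]) (by simp [hβ, h.s_right])))
  · exact Or.inr (Or.inr (Or.inr (h.algEquiv_ext (by simp [hα, h.t_left, h.s_left])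
      (by simp [hβ, h.t_right, h.s_right]))))

theorem exists_of_t_fixed (h : IsBiquadratic s t α β M P) {x : L} (hx : t x = x) :
    ∃ u v : ℚ, x = u + v * α := by
  have : CharZero L := algebraRat.charZero L
  obtain ⟨y₀, y₁, y₂, y₃, rfl⟩ := h.exists_coord x
  refine ⟨y₀, y₁, ?_⟩
  simp only [map_add, map_mul, map_ratCast, h.t_left, h.t_right] at hx
  linear_combination (-1 / 2 : L) * hx

theorem exists_of_fixed (h : IsBiquadratic s t α β M P) {x : L} (hs : s x = x) (ht : t x = x) :
    ∃ u : ℚ, x = u := by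
  have : CharZero L := algebraRat.charZero L
  obtain ⟨u, v, rfl⟩ := h.exists_of_t_fixed ht
  refine ⟨u, ?_⟩
  simp only [map_add, map_mul, map_ratCast, h.s_left] at hs
  linear_combination (-1 / 2 : L) * hs

/-! ### The four-cycle and the group it generates -/

section Cycle

open scoped Classical in
/-- The four-cycle `(1, s * t, t, s)`. -/
def cycle {G : Type*} [Group G] (s t : G) : Equiv.Perm G := [1, s * t, t, s].formPerm

theorem permGroup_eq {G : Type*} [Group G] (s t : G) :
    permGroup s t = Subgroup.closure {Equiv.mulLeft t, cycle s t} := rfl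

theorem nodup (h : IsBiquadratic s t α β M P) : [1, s * t, t, s].Nodup := by
  have h1 := h.s_ne_one
  have h2 := h.t_ne_one
  have h3 := h.s_ne_t
  have h4 : s * t ≠ 1 := fun h' => h3 (by
    rw [← mul_one s, ← h.t_mul_t, ← mul_assoc, h', one_mul])
  simp [h1, h2, h1.symm, h2.symm, h3.symm, h4.symm]

theorem cycle_one (h : IsBiquadratic s t α β M P) : cycle s t 1 = s * t := by
  classical
  simpa [cycle] using List.formPerm_apply_getElem _ h.nodup 0 (by simp)

theorem cycle_mul (h : IsBiquadratic s t α β M P) : cycle s t (s * t) = t := by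
  classical
  simpa [cycle] using List.formPerm_apply_getElem _ h.nodup 1 (by simp)

theorem cycle_t (h : IsBiquadratic s t α β M P) : cycle s t t = s := by
  classical
  simpa [cycle] using List.formPerm_apply_getElem _ h.nodup 2 (by simp)

theorem cycle_s (_h : IsBiquadratic s t α β M P) : cycle s t s = 1 := by
  classical
  simp [cycle]

theorem perm_ext (h : IsBiquadratic s t α β M P) {η θ : Equiv.Perm (L ≃ₐ[ℚ] L)}
    (h1 : η 1 = θ 1) (hs : η s = θ s) (ht : η t = θ t) (hst : η (s * t) = θ (s * t)) :
    η = θ := by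
  ext1 g
  rcases h.eq_or g with rfl | rfl | rfl | rfl <;> assumption

theorem cycle_sq (h : IsBiquadratic s t α β M P) : cycle s t ^ 2 = Equiv.mulLeft t := by
  have e1 := h.t_mul_s
  have e2 := h.t_mul_t
  have e3 : t * (s * t) = s := by rw [← mul_assoc, e1, mul_assoc, e2, mul_one]
  apply h.perm_ext <;>
    simp [pow_two, h.cycle_one, h.cycle_s, h.cycle_t, h.cycle_mul, e1, e2, e3]

theorem cycle_pow_four (h : IsBiquadratic s t α β M P) : cycle s t ^ 4 = 1 := by
  rw [show 4 = 2 * 2 from rfl, pow_mul, h.cycle_sq, pow_two, ← Equiv.mulLeft_mul, h.t_mul_t]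
  ext; simp

/-- This makes the Galois action nontrivial on `N`: `s` exchanges the coefficients of `η` and `η³`,
while `t` permutes none. -/
theorem mulLeft_s_mul_cycle (h : IsBiquadratic s t α β M P) :
    Equiv.mulLeft s * cycle s t * (Equiv.mulLeft s)⁻¹ = cycle s t ^ 3 := by
  have e3 := h.s_mul_s
  have e4 : s * (s * t) = t := by rw [← mul_assoc, e3, one_mul]
  rw [mul_inv_eq_iff_eq_mul]
  apply h.perm_ext <;>
    simp [pow_succ, h.cycle_one, h.cycle_s, h.cycle_t, h.cycle_mul, e3, e4]

theorem mulLeft_t_mul_cycle (h : IsBiquadratic s t α β M P) :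
    Equiv.mulLeft t * cycle s t * (Equiv.mulLeft t)⁻¹ = cycle s t := by
  rw [mul_inv_eq_iff_eq_mul, ← h.cycle_sq, ← pow_succ, ← pow_succ']

theorem mem_permGroup (h : IsBiquadratic s t α β M P) {η : Equiv.Perm (L ≃ₐ[ℚ] L)} :
    η ∈ permGroup s t ↔ η = 1 ∨ η = cycle s t ∨ η = cycle s t ^ 2 ∨ η = cycle s t ^ 3 := by
  have hc : cycle s t ∈ permGroup s t := Subgroup.subset_closure (by simp [cycle])
  constructor
  · intro hη
    have hle : permGroup s t ≤ Subgroup.zpowers (cycle s t) := by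
      rw [permGroup_eq, Subgroup.closure_le]
      rintro _ (rfl | rfl)
      · exact ⟨2, by rw [← h.cycle_sq]; norm_cast⟩
      · exact Subgroup.mem_zpowers _
    obtain ⟨k, rfl⟩ := hle hη
    have hk : cycle s t ^ k = cycle s t ^ (k % 4) := by
      conv_lhs => rw [← Int.emod_add_mul_ediv k 4, zpow_add, zpow_mul]
      rw [show cycle s t ^ (4 : ℤ) = 1 by exact_mod_cast h.cycle_pow_four, one_zpow, mul_one]
    have h0 := Int.emod_nonneg k (by norm_num : (4 : ℤ) ≠ 0)
    have h4 := Int.emod_lt_of_pos k (by norm_num : (0 : ℤ) < 4)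
    simp only [hk]
    generalize k % 4 = j at *
    interval_cases j
    · simp
    · simp
    · right; right; left; norm_cast
    · right; right; right; norm_cast
  · rintro (rfl | rfl | rfl | rfl)
    · exact one_mem _
    · exact hc
    · exact pow_mem hc 2
    · exact pow_mem hc 3

end Cycle

end IsBiquadratic

namespace IsBiquadratic

variable {L : Type*} [Field L] [Algebra ℚ L] {s t : L ≃ₐ[ℚ] L} {α β : L} {M P : ℚ}

/-! ### The elements of `L[N]^G` -/

open MonoidAlgebra in
/-- The element `c₀ + c₁ η + c₂ η² + c₃ η³` of the group algebra, for `η` the four-cycle. -/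
def ofCoeffs (s t : L ≃ₐ[ℚ] L) (c₀ c₁ c₂ c₃ : L) : MonoidAlgebra L (Equiv.Perm (L ≃ₐ[ℚ] L)) :=
  single 1 c₀ + single (cycle s t) c₁ + single (cycle s t ^ 2) c₂ + single (cycle s t ^ 3) c₃

theorem ofCoeffs_add (c₀ c₁ c₂ c₃ e₀ e₁ e₂ e₃ : L) :
    ofCoeffs s t (c₀ + e₀) (c₁ + e₁) (c₂ + e₂) (c₃ + e₃) =
      ofCoeffs s t c₀ c₁ c₂ c₃ + ofCoeffs s t e₀ e₁ e₂ e₃ := by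
  simp only [ofCoeffs, MonoidAlgebra.single_add]
  abel

theorem ofCoeffs_mem_range (h : IsBiquadratic s t α β M P) (c₀ c₁ c₂ c₃ : L) :
    ofCoeffs s t c₀ c₁ c₂ c₃ ∈
      (MonoidAlgebra.mapDomainAlgHom ℚ L (permGroup s t).subtype).range := by
  have key : ∀ η ∈ permGroup s t, ∀ c : L, MonoidAlgebra.single η c ∈
      (MonoidAlgebra.mapDomainAlgHom ℚ L (permGroup s t).subtype).range :=
    fun η hη c => ⟨MonoidAlgebra.single ⟨η, hη⟩ c, by simp⟩
  exact add_mem (add_mem (add_mem (key _ (h.mem_permGroup.2 (by simp)) _)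
    (key _ (h.mem_permGroup.2 (by simp)) _)) (key _ (h.mem_permGroup.2 (by simp)) _))
    (key _ (h.mem_permGroup.2 (by simp)) _)

theorem exists_ofCoeffs (h : IsBiquadratic s t α β M P)
    {x : MonoidAlgebra L (Equiv.Perm (L ≃ₐ[ℚ] L))}
    (hx : x ∈ (MonoidAlgebra.mapDomainAlgHom ℚ L (permGroup s t).subtype).range) :
    ∃ c₀ c₁ c₂ c₃ : L, x = ofCoeffs s t c₀ c₁ c₂ c₃ := by
  obtain ⟨y, rfl⟩ := hx
  induction y using MonoidAlgebra.induction_linear with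
  | zero => exact ⟨0, 0, 0, 0, by simp [ofCoeffs]⟩
  | add a b ha hb =>
    obtain ⟨c₀, c₁, c₂, c₃, hc⟩ := ha
    obtain ⟨e₀, e₁, e₂, e₃, he⟩ := hb
    exact ⟨c₀ + e₀, c₁ + e₁, c₂ + e₂, c₃ + e₃, by
      rw [ofCoeffs_add, ← hc, ← he]; exact map_add _ _ _⟩
  | single η c =>
    obtain ⟨η, hη⟩ := η
    rcases h.mem_permGroup.1 hη with rfl | rfl | rfl | rfl
    · exact ⟨c, 0, 0, 0, by simp [ofCoeffs]⟩
    · exact ⟨0, c, 0, 0, by simp [ofCoeffs]⟩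
    · exact ⟨0, 0, c, 0, by simp [ofCoeffs]⟩
    · exact ⟨0, 0, 0, c, by simp [ofCoeffs]⟩

theorem cycle_pow_apply (h : IsBiquadratic s t α β M P) :
    (cycle s t ^ 2) 1 = t ∧ (cycle s t ^ 3) 1 = s := by
  simp [pow_succ, h.cycle_one, h.cycle_mul, h.cycle_t]

theorem ofCoeffs_inj (h : IsBiquadratic s t α β M P) {c₀ c₁ c₂ c₃ e₀ e₁ e₂ e₃ : L}
    (heq : ofCoeffs s t c₀ c₁ c₂ c₃ = ofCoeffs s t e₀ e₁ e₂ e₃) :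
    c₀ = e₀ ∧ c₁ = e₁ ∧ c₂ = e₂ ∧ c₃ = e₃ := by
  classical
  have hn := h.nodup
  have e1 : (1 : Equiv.Perm (L ≃ₐ[ℚ] L)) 1 = 1 := rfl
  have e2 := h.cycle_one
  have e3 := h.cycle_pow_apply.1
  have e4 := h.cycle_pow_apply.2
  have ne : ∀ {η θ : Equiv.Perm (L ≃ₐ[ℚ] L)}, η 1 ≠ θ 1 → η ≠ θ :=
    fun hne heq => hne (by rw [heq])
  have n1 : (1 : Equiv.Perm (L ≃ₐ[ℚ] L)) ≠ cycle s t := ne (by rw [e1, e2]; simp_all)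
  have n2 : (1 : Equiv.Perm (L ≃ₐ[ℚ] L)) ≠ cycle s t ^ 2 := ne (by rw [e1, e3]; simp_all)
  have n3 : (1 : Equiv.Perm (L ≃ₐ[ℚ] L)) ≠ cycle s t ^ 3 := ne (by rw [e1, e4]; simp_all)
  have n4 : cycle s t ≠ cycle s t ^ 2 := ne (by rw [e2, e3]; simp_all)
  have n5 : cycle s t ≠ cycle s t ^ 3 := ne (by rw [e2, e4]; simp_all)
  have n6 : cycle s t ^ 2 ≠ cycle s t ^ 3 := ne (by rw [e3, e4]; simp_all)
  unfold ofCoeffs at heq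
  generalize cycle s t ^ 2 = η₂ at *
  generalize cycle s t ^ 3 = η₃ at *
  have key := fun η : Equiv.Perm (L ≃ₐ[ℚ] L) => congrArg (fun x => x.coeff η) heq
  simp only [MonoidAlgebra.coeff_add, Finsupp.add_apply, MonoidAlgebra.coeff_single,
    Finsupp.single_apply] at key
  refine ⟨?_, ?_, ?_, ?_⟩
  · simpa [n1.symm, n2.symm, n3.symm] using key 1
  · simpa [n1, n4.symm, n5.symm] using key (cycle s t)
  · simpa [n2, n4, n6.symm] using key η₂
  · simpa [n3, n5, n6] using key η₃

theorem galAct_t_ofCoeffs (h : IsBiquadratic s t α β M P) (c₀ c₁ c₂ c₃ : L) :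
    galAct t (ofCoeffs s t c₀ c₁ c₂ c₃) = ofCoeffs s t (t c₀) (t c₁) (t c₂) (t c₃) := by
  simp only [ofCoeffs, map_add, galAct_single, ← conj_pow, h.mulLeft_t_mul_cycle, mul_one,
    mul_inv_cancel]

theorem galAct_s_ofCoeffs (h : IsBiquadratic s t α β M P) (c₀ c₁ c₂ c₃ : L) :
    galAct s (ofCoeffs s t c₀ c₁ c₂ c₃) = ofCoeffs s t (s c₀) (s c₃) (s c₂) (s c₁) := by
  have e6 : cycle s t ^ 6 = cycle s t ^ 2 := by
    rw [show 6 = 4 + 2 from rfl, pow_add, h.cycle_pow_four, one_mul]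
  have e9 : cycle s t ^ 9 = cycle s t := by
    rw [show 9 = 4 + 4 + 1 from rfl, pow_add, pow_add, h.cycle_pow_four, one_mul, pow_one, one_mul]
  simp only [ofCoeffs, map_add, galAct_single, ← conj_pow, h.mulLeft_s_mul_cycle, ← pow_mul,
    Nat.reduceMul, e6, e9]
  simp only [mul_one, mul_inv_cancel]
  abel

theorem galAct_mul (g g' : L ≃ₐ[ℚ] L) (x : MonoidAlgebra L (Equiv.Perm (L ≃ₐ[ℚ] L))) :
    galAct (g * g') x = galAct g (galAct g' x) := by
  induction x using MonoidAlgebra.induction_linear with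
  | zero => simp
  | add a b ha hb => simp only [map_add, ha, hb]
  | single η c =>
    simp only [galAct_single, Equiv.mulLeft_mul]
    congr 1

theorem galAct_one (x : MonoidAlgebra L (Equiv.Perm (L ≃ₐ[ℚ] L))) : galAct 1 x = x := by
  induction x using MonoidAlgebra.induction_linear with
  | zero => simp
  | add a b ha hb => simp only [map_add, ha, hb]
  | single η c =>
    rw [galAct_single]
    congr 1

/-- The element of `L[N]^G` that acts as `p` on `1`, as `q` on `α`, and as `r + w J` on the span
of `β` and `α * β`, where `J β = α * β` and `J (α * β) = -α ^ 2 * β`. -/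
def hopfElt (s t : L ≃ₐ[ℚ] L) (α : L) (p q r w : ℚ) :
    MonoidAlgebra L (Equiv.Perm (L ≃ₐ[ℚ] L)) :=
  ofCoeffs s t ((p + q + 2 * r) / 4) ((p - q) / 4 + w / 2 * α) ((p + q - 2 * r) / 4)
    ((p - q) / 4 - w / 2 * α)

theorem hopfElt_mem (h : IsBiquadratic s t α β M P) (p q r w : ℚ) :
    hopfElt s t α p q r w ∈ hopfAlg (permGroup s t) := by
  refine Algebra.mem_inf.2 ⟨h.ofCoeffs_mem_range _ _ _ _, ?_⟩
  have hs : galAct s (hopfElt s t α p q r w) = hopfElt s t α p q r w := by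
    rw [hopfElt, h.galAct_s_ofCoeffs]
    simp only [map_add, map_sub, map_mul, map_div₀, map_ratCast, map_ofNat, h.s_left]
    congr 1 <;> ring
  have ht : galAct t (hopfElt s t α p q r w) = hopfElt s t α p q r w := by
    rw [hopfElt, h.galAct_t_ofCoeffs]
    simp only [map_add, map_sub, map_mul, map_div₀, map_ratCast, map_ofNat, h.t_left]
  rw [Algebra.mem_iInf]
  intro g
  change galAct g _ = _
  rcases h.eq_or g with rfl | rfl | rfl | rfl
  · exact galAct_one _
  · exact hs
  · exact ht
  · rw [galAct_mul, ht, hs]; rfl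

/-- Invariance under `t` and `s` puts the coefficients of `1` and `η²` in `ℚ`, that of `η` in
`ℚ(α)`, and makes that of `η³` its conjugate; the parameters come from inverting the formulas in
`hopfElt`. -/
theorem exists_hopfElt (h : IsBiquadratic s t α β M P)
    {x : MonoidAlgebra L (Equiv.Perm (L ≃ₐ[ℚ] L))} (hx : x ∈ hopfAlg (permGroup s t)) :
    ∃ p q r w : ℚ, x = hopfElt s t α p q r w := by
  have : CharZero L := algebraRat.charZero L
  obtain ⟨c₀, c₁, c₂, c₃, rfl⟩ := h.exists_ofCoeffs (Algebra.mem_inf.1 hx).1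
  have hs := galAct_eq_of_mem hx s
  have ht := galAct_eq_of_mem hx t
  rw [h.galAct_s_ofCoeffs] at hs
  rw [h.galAct_t_ofCoeffs] at ht
  obtain ⟨s0, -, s2, s3⟩ := h.ofCoeffs_inj hs
  obtain ⟨t0, t1, t2, -⟩ := h.ofCoeffs_inj ht
  obtain ⟨u₀, rfl⟩ := h.exists_of_fixed s0 t0
  obtain ⟨u₂, rfl⟩ := h.exists_of_fixed s2 t2
  obtain ⟨u, v, rfl⟩ := h.exists_of_t_fixed t1
  refine ⟨u₀ + u₂ + 2 * u, u₀ + u₂ - 2 * u, u₀ - u₂, 2 * v, ?_⟩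
  rw [hopfElt, ← s3]
  simp only [map_add, map_mul, map_ratCast, h.s_left]
  congr 1 <;> push_cast <;> ring

theorem act_hopfElt (h : IsBiquadratic s t α β M P) (p q r w y₀ y₁ y₂ y₃ : ℚ) :
    act (hopfElt s t α p q r w) (y₀ + y₁ * α + y₂ * β + y₃ * (α * β)) =
      (p * y₀ : ℚ) + (q * y₁ : ℚ) * α + (r * y₂ - w * M * y₃ : ℚ) * β +
        (r * y₃ + w * y₂ : ℚ) * (α * β) := by
  have : CharZero L := algebraRat.charZero L
  have i1 : (cycle s t)⁻¹ 1 = s := by rw [Equiv.Perm.inv_eq_iff_eq, h.cycle_s]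
  have i2 : (cycle s t ^ 2)⁻¹ 1 = t := by
    rw [Equiv.Perm.inv_eq_iff_eq, h.cycle_sq]; simp [h.t_mul_t]
  have i3 : (cycle s t ^ 3)⁻¹ 1 = s * t := by
    rw [Equiv.Perm.inv_eq_iff_eq, pow_succ]
    simp [h.cycle_mul, h.cycle_sq, h.t_mul_t]
  simp only [hopfElt, ofCoeffs, act, actAt_add, actAt_single, i1, i2, i3, inv_one,
    Equiv.Perm.one_apply, LinearMap.add_apply, LinearMap.smul_apply, AlgEquiv.toLinearMap_apply,
    AlgEquiv.one_apply, AlgEquiv.mul_apply, map_add, map_mul, map_ratCast, map_neg, h.s_left,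
    h.s_right, h.t_left, h.t_right, smul_eq_mul]
  push_cast
  rw [← h.left_sq]
  ring

theorem hopfElt_inj (h : IsBiquadratic s t α β M P) {p q r w p' q' r' w' : ℚ}
    (heq : act (hopfElt s t α p q r w) = act (hopfElt s t α p' q' r' w')) :
    p = p' ∧ q = q' ∧ r = r' ∧ w = w' := by
  -- The image of `1 + α + β` has coordinates `p, q, r, w`.
  have := LinearMap.congr_fun heq (((1 : ℚ) : L) + (1 : ℚ) * α + (1 : ℚ) * β + (0 : ℚ) * (α * β))
  rw [h.act_hopfElt, h.act_hopfElt] at this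
  simpa using h.coord_inj this

end IsBiquadratic

/-! ### Freeness over the associated order -/

/-- If `t` maps `V` into the multiples of one vector `v₀`, two distinct basis vectors would satisfy
`n j t e i = n i t e j`, which independence forbids. -/
theorem exists_generator_of_free {A V : Type*} [Ring A] [AddCommGroup V] [Module A V]
    [Module.Free A V] [Nontrivial V] [IsAddTorsionFree V] (v₀ : V) (t : A) (ht : t ≠ 0)
    (h : ∀ v : V, ∃ n : ℤ, t • v = n • v₀) : ∃ x : V, ∀ y : V, ∃ a : A, a • x = y := by
  have : Nontrivial A := ⟨t, 0, ht⟩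
  let e := Module.Free.chooseBasis A V
  choose n hn using fun i => h (e i)
  have hn0 : ∀ i, n i • v₀ ≠ 0 := fun i h0 => ht (by
    have := congrArg (fun v => e.repr v i) ((hn i).trans h0)
    simpa using this)
  have hsub : Subsingleton (Module.Free.ChooseBasisIndex A V) := by
    refine ⟨fun i j => ?_⟩
    by_contra hij
    have h1 : ((n j : A) * t) • e i = ((n i : A) * t) • e j := by
      rw [mul_smul, mul_smul, hn, hn, Int.cast_smul_eq_zsmul, Int.cast_smul_eq_zsmul,
        smul_comm]
    have h2 := congrArg (fun v => e.repr v i) h1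
    have h3 : (n j : A) * t = 0 := by simpa [Finsupp.single_apply, Ne.symm hij] using h2
    have h4 : n j • n i • v₀ = 0 := by
      rw [← hn, ← Int.cast_smul_eq_zsmul A, ← mul_smul, h3, zero_smul]
    rcases smul_eq_zero.1 h4 with h5 | h5
    · exact hn0 j (by rw [h5, zero_smul])
    · exact hn0 i h5
  obtain ⟨i⟩ : Nonempty (Module.Free.ChooseBasisIndex A V) := e.index_nonempty
  refine ⟨e i, fun y => ⟨e.repr y i, ?_⟩⟩
  have : Fintype (Module.Free.ChooseBasisIndex A V) := Fintype.ofSubsingleton i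
  conv_rhs => rw [← e.sum_repr y]
  rw [Fintype.sum_subsingleton _ i]

/-- By commutativity an annihilator of the generator annihilates all of `V`, so faithfulness makes
the orbit map injective. -/
theorem free_of_generator {A V : Type*} [Ring A] [AddCommGroup V] [Module A V]
    (hcomm : ∀ (a b : A) (v : V), a • b • v = b • a • v)
    (hfaith : ∀ a : A, (∀ v : V, a • v = 0) → a = 0) (x : V)
    (hx : ∀ y : V, ∃ a : A, a • x = y) : Module.Free A V := by
  refine Module.Free.of_equiv (LinearEquiv.ofBijective (LinearMap.toSpanSingleton A V x) ⟨?_, hx⟩)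
  rw [← LinearMap.ker_eq_bot, LinearMap.ker_eq_bot']
  intro a ha
  refine hfaith a fun v => ?_
  obtain ⟨b, rfl⟩ := hx v
  rw [hcomm, show a • x = 0 from ha, smul_zero]

theorem exists_int_of_isIntegral_ratCast {L : Type*} [Field L] [NumberField L] {q : ℚ}
    (hq : IsIntegral ℤ (q : L)) : ∃ n : ℤ, q = n := by
  have h1 : IsIntegral ℤ q := by
    have : IsIntegral ℤ (algebraMap ℚ L q) := by simpa using hq
    exact (isIntegral_algebraMap_iff (algebraMap ℚ L).injective).1 this
  obtain ⟨n, hn⟩ := IsIntegrallyClosed.isIntegral_iff.1 h1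
  exact ⟨n, by simpa using hn.symm⟩

namespace IsBiquadratic

variable {L : Type*} [Field L] [NumberField L] {s t : L ≃ₐ[ℚ] L} {α β : L} {M P : ℚ}

theorem isIntegral_map (g : L ≃ₐ[ℚ] L) {x : L} (hx : IsIntegral ℤ x) : IsIntegral ℤ (g x) :=
  hx.map (g.toAlgHom.restrictScalars ℤ)

/-- With parameters `4, 0, 0, 0` all four coefficients are `1`, so this element acts as the trace.
-/
theorem exists_int_act_trace (h : IsBiquadratic s t α β M P) {x : L} (hx : IsIntegral ℤ x) :
    ∃ n : ℤ, act (hopfElt s t α 4 0 0 0) x = n := by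
  obtain ⟨y₀, y₁, y₂, y₃, rfl⟩ := h.exists_coord x
  have hs := isIntegral_map s hx
  have ht := isIntegral_map t hx
  have hst := isIntegral_map s ht
  have hsum := ((hx.add hs).add ht).add hst
  simp only [map_add, map_mul, map_ratCast, map_neg, h.s_left, h.s_right, h.t_left,
    h.t_right] at hsum
  have e : ((4 * y₀ : ℚ) : L) =
      y₀ + y₁ * α + y₂ * β + y₃ * (α * β) + (y₀ + y₁ * -α + y₂ * β + y₃ * (-α * β)) +
        (y₀ + y₁ * α + y₂ * -β + y₃ * (α * -β)) +
        (y₀ + y₁ * -α + y₂ * -β + y₃ * (-α * -β)) := by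
    push_cast
    ring
  rw [← e] at hsum
  obtain ⟨n, hn⟩ := exists_int_of_isIntegral_ratCast hsum
  refine ⟨n, ?_⟩
  rw [h.act_hopfElt, hn]
  simp

theorem isFree_iff (h : IsBiquadratic s t α β M P) :
    IsFreeOverAssocOrder (permGroup s t) ↔ ∃ x : L, IsIntegral ℤ x ∧ ∀ y : L, IsIntegral ℤ y →
      ∃ p q r w : ℚ, (∀ z : L, IsIntegral ℤ z → IsIntegral ℤ (act (hopfElt s t α p q r w) z)) ∧
        act (hopfElt s t α p q r w) x = y := by
  let _ : Module (assocOrder (permGroup s t)) (𝓞 L) :=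
    Module.compHom (𝓞 L) (assocOrderRep (permGroup s t))
  have smul_def : ∀ (a : assocOrder (permGroup s t)) (x : 𝓞 L),
      ((a • x : 𝓞 L) : L) = act (a.1 : MonoidAlgebra L (Equiv.Perm (L ≃ₐ[ℚ] L))) (x : L) :=
    fun a x => rfl
  have lift : ∀ x : L, IsIntegral ℤ x → ∃ x' : 𝓞 L, (x' : L) = x := fun x hx => ⟨⟨x, hx⟩, rfl⟩
  have mk : ∀ p q r w : ℚ,
      (∀ z : L, IsIntegral ℤ z → IsIntegral ℤ (act (hopfElt s t α p q r w) z)) →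
      ∃ a : assocOrder (permGroup s t),
        (a.1 : MonoidAlgebra L (Equiv.Perm (L ≃ₐ[ℚ] L))) = hopfElt s t α p q r w :=
    fun p q r w hz => ⟨⟨⟨_, h.hopfElt_mem p q r w⟩, fun x => hz x x.isIntegral_coe⟩, rfl⟩
  change Module.Free (assocOrder (permGroup s t)) (𝓞 L) ↔ _
  constructor
  · intro hfree
    obtain ⟨a, ha⟩ := mk 4 0 0 0 fun z hz => by
      obtain ⟨n, hn⟩ := h.exists_int_act_trace hz
      rw [hn]
      exact isIntegral_algebraMap (R := ℤ) (A := L) (x := n)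
    have ha0 : a ≠ 0 := by
      rintro rfl
      have h1 := h.act_hopfElt 4 0 0 0 1 0 0 0
      rw [← ha] at h1
      simp [act, actAt_zero] at h1
    obtain ⟨x, hx⟩ := exists_generator_of_free (1 : 𝓞 L) a ha0 fun v => by
      obtain ⟨n, hn⟩ := h.exists_int_act_trace v.isIntegral_coe
      refine ⟨n, NumberField.RingOfIntegers.ext ?_⟩
      rw [smul_def, ha, hn]
      simp
    refine ⟨x, x.isIntegral_coe, fun y hy => ?_⟩
    obtain ⟨y, rfl⟩ := lift y hy
    obtain ⟨b, hb⟩ := hx y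
    obtain ⟨p, q, r, w, hpq⟩ := h.exists_hopfElt b.1.2
    refine ⟨p, q, r, w, fun z hz => ?_, ?_⟩
    · rw [← hpq]
      exact b.2 ⟨z, hz⟩
    · rw [← hpq, ← smul_def, hb]
  · rintro ⟨x, hx, hgen⟩
    obtain ⟨x, rfl⟩ := lift x hx
    refine free_of_generator (fun a b v => ?_) (fun a ha => ?_) x fun y => ?_
    · obtain ⟨p, q, r, w, ha⟩ := h.exists_hopfElt a.1.2
      obtain ⟨p', q', r', w', hb⟩ := h.exists_hopfElt b.1.2
      obtain ⟨y₀, y₁, y₂, y₃, hy⟩ := h.exists_coord (v : L)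
      refine NumberField.RingOfIntegers.ext ?_
      simp only [smul_def, ha, hb, hy, h.act_hopfElt]
      push_cast
      ring
    · obtain ⟨p, q, r, w, hpq⟩ := h.exists_hopfElt a.1.2
      -- Every element of `L` has a nonzero integer multiple in `𝓞 L`, so killing `𝓞 L` means
      -- killing `L`.
      have hact : act (hopfElt s t α p q r w) = act (hopfElt s t α 0 0 0 0) := by
        ext z
        obtain ⟨n, hn, hz⟩ := exists_integral_multiples ℤ ℚ {z}
        have h1 : act (hopfElt s t α p q r w) (n • z) = 0 := by
          obtain ⟨v, hv⟩ := lift _ (hz z (by simp))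
          rw [← hpq, ← hv, ← smul_def, ha]
          rfl
        have h2 : act (hopfElt s t α p q r w) z = 0 := by
          rw [map_zsmul] at h1
          exact (smul_eq_zero.1 h1).resolve_left hn
        obtain ⟨y₀, y₁, y₂, y₃, rfl⟩ := h.exists_coord z
        rw [h2, h.act_hopfElt]
        simp
      obtain ⟨rfl, rfl, rfl, rfl⟩ := h.hopfElt_inj hact
      refine Subtype.ext (Subtype.ext ?_)
      rw [hpq]
      simp [hopfElt, ofCoeffs]
    · obtain ⟨p, q, r, w, hz, hy⟩ := hgen y y.isIntegral_coe
      obtain ⟨a, ha⟩ := mk p q r w hz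
      refine ⟨a, NumberField.RingOfIntegers.ext ?_⟩
      rw [smul_def, ha]
      exact hy

end IsBiquadratic

/-! ### The ring of integers -/

theorem exists_int_of_sq_mul {D k : ℤ} {q : ℚ} (hD : Squarefree D) (h : q ^ 2 * D = k) :
    ∃ n : ℤ, q = n := by
  have hden : (q.den : ℚ) ≠ 0 := by exact_mod_cast q.den_nz
  have h1 : q.num ^ 2 * D = k * (q.den : ℤ) ^ 2 := by
    have h2 : ((q.num : ℚ) / q.den) ^ 2 * D = k := by rwa [Rat.num_div_den]
    rw [div_pow, div_mul_eq_mul_div, div_eq_iff (pow_ne_zero 2 hden)] at h2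
    exact_mod_cast h2
  have hcop : IsCoprime ((q.den : ℤ) ^ 2) (q.num ^ 2) :=
    (Int.isCoprime_iff_gcd_eq_one.2 (by
      rw [Int.gcd_comm]; simpa [Int.gcd, Nat.Coprime] using q.reduced)).pow
  have h3 : (q.den : ℤ) ^ 2 ∣ D := hcop.dvd_of_dvd_mul_left ⟨k, by rw [h1, mul_comm]⟩
  have h4 := hD _ ((pow_two (q.den : ℤ)).symm ▸ h3)
  have h5 : q.den = 1 := by simpa using Int.isUnit_iff_natAbs_eq.1 h4
  exact ⟨q.num, (Rat.den_eq_one_iff q).1 h5 |>.symm⟩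

/-- Trace and norm make `A = 2u` and `B = 2v` integers with `A² ≡ D B²` mod `4`; for `D ≡ 2, 3` this
forces both to be even. -/
theorem exists_int_of_isIntegral_add_mul {L : Type*} [Field L] [NumberField L]
    (g : L ≃ₐ[ℚ] L) {e : L} {D : ℤ} (hg : g e = -e) (he : e ^ 2 = D) (hD : Squarefree D)
    (hD4 : D % 4 = 2 ∨ D % 4 = 3) {u v : ℚ} (hx : IsIntegral ℤ ((u : L) + v * e)) :
    ∃ U V : ℤ, u = U ∧ v = V := by
  have hgx := IsBiquadratic.isIntegral_map g hx
  simp only [map_add, map_mul, map_ratCast, hg] at hgx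
  have e1 : ((2 * u : ℚ) : L) = (u + v * e) + (u + v * -e) := by push_cast; ring
  have e2 : ((u ^ 2 - D * v ^ 2 : ℚ) : L) = (u + v * e) * (u + v * -e) := by
    push_cast; rw [← he]; ring
  obtain ⟨A, hA⟩ := exists_int_of_isIntegral_ratCast (e1 ▸ hx.add hgx)
  obtain ⟨C, hC⟩ := exists_int_of_isIntegral_ratCast (e2 ▸ hx.mul hgx)
  obtain ⟨B, hB⟩ := exists_int_of_sq_mul (q := 2 * v) (k := A ^ 2 - 4 * C) hD (by
    push_cast; rw [← hA, ← hC]; ring)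
  have hABC : A ^ 2 - D * B ^ 2 = 4 * C := by
    have : ((A ^ 2 - D * B ^ 2 : ℤ) : ℚ) = (4 * C : ℤ) := by
      push_cast; rw [← hA, ← hB, ← hC]; ring
    exact_mod_cast this
  have hpar : (∃ U, A = 2 * U) ∧ ∃ V, B = 2 * V := by
    rcases Int.even_or_odd' A with ⟨U, rfl | rfl⟩ <;> rcases Int.even_or_odd' B with ⟨V, rfl | rfl⟩
    · exact ⟨⟨U, rfl⟩, V, rfl⟩
    all_goals
      exfalso
      ring_nf at hABC
      have h4 := Int.emod_add_mul_ediv D 4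
      generalize D / 4 = E at h4
      rcases hD4 with h | h <;> rw [h] at h4 <;> subst h4 <;> ring_nf at hABC <;> omega
  obtain ⟨⟨U, rfl⟩, V, rfl⟩ := hpar
  exact ⟨U, V, by push_cast at hA; linarith, by push_cast at hB; linarith⟩

/-- The field `L` is `ℚ(√(d m₁), √(d n₁))`, with `a`, `b`, `c` square roots of the square-free
`d m₁`, `d n₁`, `m₁ n₁`, of which the first is `3` and the other two are `2` modulo `4`. -/
structure IsBiquadraticInt {L : Type*} [Field L] [NumberField L] (σ τ : L ≃ₐ[ℚ] L) (a b c : L)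
    (d m₁ n₁ : ℤ) : Prop where
  isBiquadratic : IsBiquadratic σ τ a b (d * m₁) (d * n₁)
  d_mul_c : (d : L) * c = a * b
  d_pos : 0 < d
  m₁_pos : 0 < m₁
  n₁_pos : 0 < n₁
  squarefree_dm : Squarefree (d * m₁)
  squarefree_dn : Squarefree (d * n₁)
  squarefree_mn : Squarefree (m₁ * n₁)
  dm_mod : d * m₁ % 4 = 3
  n₁_mod : n₁ % 4 = 2

/-- Coordinates with respect to the basis `1, a, b, c` that describe integral elements. -/
def IsIntegralCoord (y : ℚ × ℚ × ℚ × ℚ) : Prop :=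
  ∃ A B C D : ℤ, y = ((A : ℚ), (B : ℚ), (C / 2 : ℚ), (C / 2 + D : ℚ))

/-- The element of `L` with the given coordinates with respect to `1, a, b, c`. -/
def ofCoord {L : Type*} [Field L] (a b c : L) (y : ℚ × ℚ × ℚ × ℚ) : L :=
  y.1 + y.2.1 * a + y.2.2.1 * b + y.2.2.2 * c

namespace IsBiquadraticInt

variable {L : Type*} [Field L] [NumberField L] {σ τ : L ≃ₐ[ℚ] L} {a b c : L} {d m₁ n₁ : ℤ}

theorem d_ne_zero (h : IsBiquadraticInt σ τ a b c d m₁ n₁) : (d : L) ≠ 0 := by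
  exact_mod_cast h.d_pos.ne'

theorem a_sq (h : IsBiquadraticInt σ τ a b c d m₁ n₁) : a ^ 2 = d * m₁ := by
  rw [h.isBiquadratic.left_sq]; push_cast; rfl

theorem b_sq (h : IsBiquadraticInt σ τ a b c d m₁ n₁) : b ^ 2 = d * n₁ := by
  rw [h.isBiquadratic.right_sq]; push_cast; rfl

theorem c_sq (h : IsBiquadraticInt σ τ a b c d m₁ n₁) : c ^ 2 = m₁ * n₁ := by
  apply mul_left_cancel₀ (pow_ne_zero 2 h.d_ne_zero)
  linear_combination (d * c + a * b) * h.d_mul_c + b ^ 2 * h.a_sq + d * m₁ * h.b_sq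

theorem b_mul_c (h : IsBiquadraticInt σ τ a b c d m₁ n₁) : b * c = n₁ * a := by
  apply mul_left_cancel₀ h.d_ne_zero
  linear_combination b * h.d_mul_c + a * h.b_sq

theorem a_mul_c (h : IsBiquadraticInt σ τ a b c d m₁ n₁) : a * c = m₁ * b := by
  apply mul_left_cancel₀ h.d_ne_zero
  linear_combination a * h.d_mul_c + b * h.a_sq

theorem σ_c (h : IsBiquadraticInt σ τ a b c d m₁ n₁) : σ c = -c := by
  apply mul_left_cancel₀ h.d_ne_zero
  have := congrArg σ h.d_mul_c
  simp only [map_mul, map_intCast, h.isBiquadratic.s_left, h.isBiquadratic.s_right] at this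
  linear_combination this + h.d_mul_c

theorem τ_c (h : IsBiquadraticInt σ τ a b c d m₁ n₁) : τ c = -c := by
  apply mul_left_cancel₀ h.d_ne_zero
  have := congrArg τ h.d_mul_c
  simp only [map_mul, map_intCast, h.isBiquadratic.t_left, h.isBiquadratic.t_right] at this
  linear_combination this + h.d_mul_c

theorem ofCoord_surj (h : IsBiquadraticInt σ τ a b c d m₁ n₁) (x : L) :
    ∃ y, x = ofCoord a b c y := by
  obtain ⟨y₀, y₁, y₂, y₃, rfl⟩ := h.isBiquadratic.exists_coord x
  refine ⟨(y₀, y₁, y₂, y₃ * d), ?_⟩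
  simp only [ofCoord]
  push_cast
  linear_combination -y₃ * h.d_mul_c

theorem ofCoord_inj (h : IsBiquadraticInt σ τ a b c d m₁ n₁) {y z : ℚ × ℚ × ℚ × ℚ}
    (hyz : ofCoord a b c y = ofCoord a b c z) : y = z := by
  obtain ⟨y₀, y₁, y₂, y₃⟩ := y
  obtain ⟨z₀, z₁, z₂, z₃⟩ := z
  have hd := h.d_ne_zero
  have hd' : (d : ℚ) ≠ 0 := by exact_mod_cast h.d_pos.ne'
  have hc : c = a * b / d := by rw [eq_div_iff hd, mul_comm, h.d_mul_c]
  have := h.isBiquadratic.coord_inj (y₀ := y₀) (y₁ := y₁) (y₂ := y₂) (y₃ := y₃ / d)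
    (z₀ := z₀) (z₁ := z₁) (z₂ := z₂) (z₃ := z₃ / d) (by
      simp only [ofCoord, hc] at hyz
      push_cast
      linear_combination hyz)
  obtain ⟨rfl, rfl, rfl, h3⟩ := this
  rw [div_left_inj' hd'] at h3
  rw [h3]

theorem isIntegral_of_sq {L : Type*} [Field L] {x : L} {A : ℤ} (hx : x ^ 2 = A) : IsIntegral ℤ x :=
  IsIntegral.of_pow two_pos (hx ▸ isIntegral_algebraMap (R := ℤ) (A := L) (x := A))

theorem odd_d (h : IsBiquadraticInt σ τ a b c d m₁ n₁) : d % 2 = 1 := by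
  have := h.dm_mod
  rcases Int.even_or_odd' d with ⟨k, hk | hk⟩
  · rw [hk, mul_assoc] at this; omega
  · omega

theorem d_add_m₁ (h : IsBiquadraticInt σ τ a b c d m₁ n₁) : (d + m₁) % 4 = 0 := by
  have h1 := h.dm_mod
  rw [Int.mul_emod] at h1
  have h2 := Int.emod_nonneg d (by norm_num : (4 : ℤ) ≠ 0)
  have h3 := Int.emod_lt_of_pos d (by norm_num : (0 : ℤ) < 4)
  have h4 := Int.emod_nonneg m₁ (by norm_num : (4 : ℤ) ≠ 0)
  have h5 := Int.emod_lt_of_pos m₁ (by norm_num : (0 : ℤ) < 4)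
  rw [Int.add_emod]
  generalize d % 4 = x at *
  generalize m₁ % 4 = y at *
  interval_cases x <;> interval_cases y <;> omega

theorem isIntegral_half (h : IsBiquadraticInt σ τ a b c d m₁ n₁) :
    IsIntegral ℤ ((b + c) / 2) := by
  obtain ⟨n₂, hn₂⟩ : ∃ n₂, n₁ = 2 * n₂ := ⟨n₁ / 2, by have := h.n₁_mod; omega⟩
  obtain ⟨e, he⟩ : ∃ e, d + m₁ = 2 * e := ⟨(d + m₁) / 2, by have := h.d_add_m₁; omega⟩
  have hn : (n₁ : L) = 2 * n₂ := by exact_mod_cast hn₂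
  have he' : (d + m₁ : L) = 2 * e := by exact_mod_cast he
  -- The square is `n₁ (d + m₁ + 2a) / 4`, and `n₁` and `d + m₁` are both even.
  have hsq : ((b + c) / 2) ^ 2 = n₂ * (e + a) := by
    linear_combination (1 / 4 : L) * (h.b_sq + h.c_sq + 2 * h.b_mul_c) +
      (1 / 4 : L) * (d + m₁ + 2 * a) * hn + (n₂ / 2 : L) * he'
  have int : ∀ k : ℤ, IsIntegral ℤ (k : L) :=
    fun k => isIntegral_algebraMap (R := ℤ) (A := L) (x := k)
  have ha : IsIntegral ℤ a := isIntegral_of_sq (A := d * m₁) (by rw [h.a_sq]; push_cast; rfl)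
  exact IsIntegral.of_pow two_pos (hsq ▸ (int n₂).mul ((int e).add ha))

theorem isIntegral_iff (h : IsBiquadraticInt σ τ a b c d m₁ n₁) (y : ℚ × ℚ × ℚ × ℚ) :
    IsIntegral ℤ (ofCoord a b c y) ↔ IsIntegralCoord y := by
  have int : ∀ k : ℤ, IsIntegral ℤ (k : L) :=
    fun k => isIntegral_algebraMap (R := ℤ) (A := L) (x := k)
  constructor
  · intro hx
    obtain ⟨y₀, y₁, y₂, y₃⟩ := y
    have hx1 := IsBiquadratic.isIntegral_map σ hx
    have hx2 := IsBiquadratic.isIntegral_map τ hx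
    have hx3 := IsBiquadratic.isIntegral_map σ hx2
    simp only [ofCoord, map_add, map_mul, map_ratCast, map_neg, h.isBiquadratic.s_left,
      h.isBiquadratic.s_right, h.isBiquadratic.t_left, h.isBiquadratic.t_right, h.σ_c, h.τ_c]
      at hx hx1 hx2 hx3
    have ea : ((2 * y₀ : ℚ) : L) + (2 * y₁ : ℚ) * a =
        (y₀ + y₁ * a + y₂ * b + y₃ * c) + (y₀ + y₁ * a + y₂ * -b + y₃ * -c) := by
      push_cast; ring
    have eb : ((2 * y₀ : ℚ) : L) + (2 * y₂ : ℚ) * b =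
        (y₀ + y₁ * a + y₂ * b + y₃ * c) + (y₀ + y₁ * -a + y₂ * b + y₃ * -c) := by
      push_cast; ring
    have ec : ((2 * y₀ : ℚ) : L) + (2 * y₃ : ℚ) * c =
        (y₀ + y₁ * a + y₂ * b + y₃ * c) + (y₀ + y₁ * -a + y₂ * -b + y₃ * - -c) := by
      push_cast; ring
    -- The sums with conjugates lie in the quadratic subfields and bound the denominators by `2`.
    -- The relative norm to `ℚ(a)` gives the remaining parity conditions.
    have en : ((y₀ ^ 2 + d * m₁ * y₁ ^ 2 - d * n₁ * y₂ ^ 2 - m₁ * n₁ * y₃ ^ 2 : ℚ) : L) +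
        (2 * y₀ * y₁ - 2 * y₂ * y₃ * n₁ : ℚ) * a =
        (y₀ + y₁ * a + y₂ * b + y₃ * c) * (y₀ + y₁ * a + y₂ * -b + y₃ * -c) := by
      push_cast
      linear_combination -y₁ ^ 2 * h.a_sq + y₂ ^ 2 * h.b_sq + y₃ ^ 2 * h.c_sq +
        2 * y₂ * y₃ * h.b_mul_c
    obtain ⟨A, B, hA, hB⟩ := exists_int_of_isIntegral_add_mul σ h.isBiquadratic.s_left
      (D := d * m₁) (by rw [h.a_sq]; push_cast; rfl) h.squarefree_dm (Or.inr h.dm_mod)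
      (ea ▸ hx.add hx2)
    have hdn : d * n₁ % 4 = 2 := by
      have h1 := h.n₁_mod
      have h2 := h.odd_d
      obtain ⟨k, rfl⟩ : ∃ k, d = 2 * k + 1 := ⟨d / 2, by omega⟩
      obtain ⟨l, rfl⟩ : ∃ l, n₁ = 4 * l + 2 := ⟨n₁ / 4, by omega⟩
      ring_nf; omega
    have hmn : m₁ * n₁ % 4 = 2 := by
      have h1 := h.n₁_mod
      have h2 := h.odd_d
      have h3 := h.d_add_m₁
      obtain ⟨k, rfl⟩ : ∃ k, m₁ = 2 * k + 1 := ⟨m₁ / 2, by omega⟩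
      obtain ⟨l, rfl⟩ : ∃ l, n₁ = 4 * l + 2 := ⟨n₁ / 4, by omega⟩
      ring_nf; omega
    obtain ⟨-, C, -, hC⟩ := exists_int_of_isIntegral_add_mul τ h.isBiquadratic.t_right
      (D := d * n₁) (by rw [h.b_sq]; push_cast; rfl) h.squarefree_dn (Or.inl hdn)
      (eb ▸ hx.add hx1)
    obtain ⟨-, D, -, hD⟩ := exists_int_of_isIntegral_add_mul τ h.τ_c
      (D := m₁ * n₁) (by rw [h.c_sq]; push_cast; rfl) h.squarefree_mn (Or.inl hmn)
      (ec ▸ hx.add hx3)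
    obtain ⟨E, F, hE, hF⟩ := exists_int_of_isIntegral_add_mul σ h.isBiquadratic.s_left
      (D := d * m₁) (by rw [h.a_sq]; push_cast; rfl) h.squarefree_dm (Or.inr h.dm_mod)
      (en ▸ hx.mul hx2)
    obtain rfl : y₀ = A / 2 := by linarith
    obtain rfl : y₁ = B / 2 := by linarith
    obtain rfl : y₂ = C / 2 := by linarith
    obtain rfl : y₃ = D / 2 := by linarith
    have i1 : A ^ 2 + d * m₁ * B ^ 2 - d * n₁ * C ^ 2 - m₁ * n₁ * D ^ 2 = 4 * E := by
      have : ((A ^ 2 + d * m₁ * B ^ 2 - d * n₁ * C ^ 2 - m₁ * n₁ * D ^ 2 : ℤ) : ℚ) =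
        (4 * E : ℤ) := by push_cast; rw [← hE]; ring
      exact_mod_cast this
    have i2 : A * B - C * D * n₁ = 2 * F := by
      have : ((A * B - C * D * n₁ : ℤ) : ℚ) = (2 * F : ℤ) := by push_cast; rw [← hF]; ring
      exact_mod_cast this
    -- Modulo `2`, `i1` gives `A ≡ B` and `i2` gives `A B ≡ 0`, so both are even; then `i1` modulo
    -- `4` gives `C ≡ D`.
    obtain ⟨U, V, W, rfl, rfl, rfl⟩ : ∃ U V W, A = 2 * U ∧ B = 2 * V ∧ D = C + 2 * W := by
      have h0 := h.dm_mod
      have h1 := h.n₁_mod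
      obtain ⟨k, hk⟩ : ∃ k, d * m₁ = 4 * k + 3 := ⟨d * m₁ / 4, by omega⟩
      obtain ⟨l, hl⟩ : ∃ l, d * n₁ = 4 * l + 2 := ⟨d * n₁ / 4, by omega⟩
      obtain ⟨j, hj⟩ : ∃ j, m₁ * n₁ = 4 * j + 2 := ⟨m₁ * n₁ / 4, by omega⟩
      obtain ⟨i, hi⟩ : ∃ i, n₁ = 4 * i + 2 := ⟨n₁ / 4, by omega⟩
      rw [hk, hl, hj] at i1
      rw [hi] at i2
      clear * - i1 i2
      rcases Int.even_or_odd' A with ⟨A, rfl | rfl⟩ <;>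
      rcases Int.even_or_odd' B with ⟨B, rfl | rfl⟩ <;>
      rcases Int.even_or_odd' C with ⟨C, rfl | rfl⟩ <;>
      rcases Int.even_or_odd' D with ⟨D, rfl | rfl⟩ <;>
      first
      | exact ⟨A, B, D - C, rfl, rfl, by omega⟩
      | (exfalso; ring_nf at i1 i2; omega)
    refine ⟨U, V, C, W, ?_⟩
    simp only [Prod.mk.injEq]
    refine ⟨?_, ?_, ?_, ?_⟩ <;> push_cast <;> ring
  · rintro ⟨A, B, C, D, rfl⟩
    have ha : IsIntegral ℤ a := isIntegral_of_sq (A := d * m₁) (by rw [h.a_sq]; push_cast; rfl)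
    have hc : IsIntegral ℤ c := isIntegral_of_sq (A := m₁ * n₁) (by rw [h.c_sq]; push_cast; rfl)
    have e : ofCoord a b c ((A : ℚ), (B : ℚ), (C / 2 : ℚ), (C / 2 + D : ℚ)) =
        A + B * a + C * ((b + c) / 2) + D * c := by
      simp only [ofCoord]; push_cast; ring
    rw [e]
    exact (((int A).add ((int B).mul ha)).add ((int C).mul h.isIntegral_half)).add
      ((int D).mul hc)

end IsBiquadraticInt

/-! ### The action on integral coordinates -/

namespace IsBiquadratic

variable {L : Type*} [Field L] [Algebra ℚ L] {s t : L ≃ₐ[ℚ] L} {α β : L} {M P : ℚ}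

theorem swap (h : IsBiquadratic s t α β M P) : IsBiquadratic t s β α P M where
  s_left := h.t_right
  s_right := h.t_left
  t_left := h.s_right
  t_right := h.s_left
  left_ne_zero := h.right_ne_zero
  right_ne_zero := h.left_ne_zero
  left_sq := h.right_sq
  right_sq := h.left_sq
  exists_coord x := by
    obtain ⟨y₀, y₁, y₂, y₃, rfl⟩ := h.exists_coord x
    exact ⟨y₀, y₂, y₁, y₃, by ring⟩

/-- Together with `swap`, this brings the structures of `⟨σ⟩` and `⟨στ⟩` under the results for
`permGroup s t`. -/
theorem mul_left (h : IsBiquadratic s t α β M P) :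
    IsBiquadratic s (s * t) (α * β) β (M * P) P where
  s_left := by simp [h.s_left, h.s_right]
  s_right := h.s_right
  t_left := by simp [h.s_left, h.s_right, h.t_left, h.t_right]
  t_right := by simp [h.s_right, h.t_right]
  left_ne_zero := mul_ne_zero h.left_ne_zero h.right_ne_zero
  right_ne_zero := h.right_ne_zero
  left_sq := by
    have : CharZero L := algebraRat.charZero L
    rw [mul_pow, h.left_sq, h.right_sq]; push_cast; rfl
  right_sq := h.right_sq
  exists_coord x := by
    have : CharZero L := algebraRat.charZero L
    have hP : (P : L) ≠ 0 := h.right_sq ▸ pow_ne_zero 2 h.right_ne_zero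
    obtain ⟨y₀, y₁, y₂, y₃, rfl⟩ := h.exists_coord x
    refine ⟨y₀, y₃, y₂, y₁ / P, ?_⟩
    push_cast
    field_simp
    linear_combination -y₁ * α * h.right_sq

end IsBiquadratic

/-- The lattice of integral coordinates is generated by one element, over those of the
operators `T p q r w` that preserve it. -/
def HasGenerator (T : ℚ → ℚ → ℚ → ℚ → ℚ × ℚ × ℚ × ℚ → ℚ × ℚ × ℚ × ℚ) : Prop :=
  ∃ x, IsIntegralCoord x ∧ ∀ y, IsIntegralCoord y → ∃ p q r w,
    (∀ z, IsIntegralCoord z → IsIntegralCoord (T p q r w z)) ∧ T p q r w x = y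

namespace IsBiquadraticInt

variable {L : Type*} [Field L] [NumberField L] {σ τ : L ≃ₐ[ℚ] L} {a b c : L} {d m₁ n₁ : ℤ}

theorem isFree_iff_hasGenerator (h : IsBiquadraticInt σ τ a b c d m₁ n₁)
    {s t : L ≃ₐ[ℚ] L} {α β : L} {M P : ℚ} (h' : IsBiquadratic s t α β M P)
    {T : ℚ → ℚ → ℚ → ℚ → ℚ × ℚ × ℚ × ℚ → ℚ × ℚ × ℚ × ℚ}
    (hT : ∀ p q r w y, act (IsBiquadratic.hopfElt s t α p q r w) (ofCoord a b c y) =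
      ofCoord a b c (T p q r w y)) :
    IsFreeOverAssocOrder (permGroup s t) ↔ HasGenerator T := by
  rw [h'.isFree_iff]
  constructor
  · rintro ⟨x, hx, hgen⟩
    obtain ⟨x, rfl⟩ := h.ofCoord_surj x
    refine ⟨x, (h.isIntegral_iff x).1 hx, fun y hy => ?_⟩
    obtain ⟨p, q, r, w, hz, hxy⟩ := hgen _ ((h.isIntegral_iff y).2 hy)
    refine ⟨p, q, r, w, fun z hz' => ?_, h.ofCoord_inj ((hT p q r w x).symm.trans hxy)⟩
    rw [← h.isIntegral_iff, ← hT]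
    exact hz _ ((h.isIntegral_iff z).2 hz')
  · rintro ⟨x, hx, hgen⟩
    refine ⟨_, (h.isIntegral_iff x).2 hx, fun y hy => ?_⟩
    obtain ⟨y, rfl⟩ := h.ofCoord_surj y
    obtain ⟨p, q, r, w, hz, hxy⟩ := hgen _ ((h.isIntegral_iff y).1 hy)
    refine ⟨p, q, r, w, fun z hz' => ?_, by rw [hT, hxy]⟩
    obtain ⟨z, rfl⟩ := h.ofCoord_surj z
    rw [hT, h.isIntegral_iff]
    exact hz _ ((h.isIntegral_iff z).1 hz')

theorem isFree_permGroup_iff (h : IsBiquadraticInt σ τ a b c d m₁ n₁) :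
    IsFreeOverAssocOrder (permGroup σ τ) ↔ HasGenerator fun p q r w y =>
      (p * y.1, q * y.2.1, r * y.2.2.1 - w * m₁ * y.2.2.2, r * y.2.2.2 + w * d * y.2.2.1) := by
  refine h.isFree_iff_hasGenerator h.isBiquadratic fun p q r w ⟨y₀, y₁, y₂, y₃⟩ => ?_
  have hd := h.d_ne_zero
  have hc : c = a * b / d := by rw [eq_div_iff hd, mul_comm, h.d_mul_c]
  have key := h.isBiquadratic.act_hopfElt p q r w y₀ y₁ y₂ (y₃ / d)
  rw [show ofCoord a b c (y₀, y₁, y₂, y₃) =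
    y₀ + y₁ * a + y₂ * b + (y₃ / d : ℚ) * (a * b) by simp only [ofCoord, hc]; push_cast; ring, key]
  simp only [ofCoord, hc]
  push_cast
  field_simp

theorem isFree_permGroup_swap_iff (h : IsBiquadraticInt σ τ a b c d m₁ n₁) :
    IsFreeOverAssocOrder (permGroup τ σ) ↔ HasGenerator fun p q r w y =>
      (p * y.1, r * y.2.1 - w * n₁ * y.2.2.2, q * y.2.2.1, r * y.2.2.2 + w * d * y.2.1) := by
  refine h.isFree_iff_hasGenerator h.isBiquadratic.swap fun p q r w ⟨y₀, y₁, y₂, y₃⟩ => ?_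
  have hd := h.d_ne_zero
  have hc : c = a * b / d := by rw [eq_div_iff hd, mul_comm, h.d_mul_c]
  have key := h.isBiquadratic.swap.act_hopfElt p q r w y₀ y₂ y₁ (y₃ / d)
  rw [show ofCoord a b c (y₀, y₁, y₂, y₃) =
    y₀ + y₂ * b + y₁ * a + (y₃ / d : ℚ) * (b * a) by simp only [ofCoord, hc]; push_cast; ring, key]
  simp only [ofCoord, hc]
  push_cast
  field_simp
  ring

theorem isFree_permGroup_mul_iff (h : IsBiquadraticInt σ τ a b c d m₁ n₁) :
    IsFreeOverAssocOrder (permGroup σ (σ * τ)) ↔ HasGenerator fun p q r w y =>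
      (p * y.1, r * y.2.1 + w * d * n₁ * y.2.2.1, r * y.2.2.1 - w * d * m₁ * y.2.1,
        q * y.2.2.2) := by
  refine h.isFree_iff_hasGenerator h.isBiquadratic.mul_left fun p q r w ⟨y₀, y₁, y₂, y₃⟩ => ?_
  have hd := h.d_ne_zero
  have hn : (n₁ : L) ≠ 0 := by exact_mod_cast h.n₁_pos.ne'
  have hc : c = a * b / d := by rw [eq_div_iff hd, mul_comm, h.d_mul_c]
  have key := h.isBiquadratic.mul_left.act_hopfElt p q r w y₀ (y₃ / d) y₂ (y₁ / (d * n₁))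
  have hb := h.b_sq
  rw [show ofCoord a b c (y₀, y₁, y₂, y₃) = y₀ + (y₃ / d : ℚ) * (a * b) + y₂ * b +
      (y₁ / (d * n₁) : ℚ) * (a * b * b) by
    simp only [ofCoord, hc]
    push_cast
    field_simp
    linear_combination -y₁ * a * hb, key]
  simp only [ofCoord, hc]
  push_cast
  field_simp
  linear_combination (a * r * y₁ + a * w * d * n₁ * y₂) * hb

end IsBiquadraticInt

/-! ### Arithmetic of the lattice -/

section Arithmetic

variable {d m₁ n₁ : ℤ}

theorem isUnit_of_dvd_of_squarefree_mul {x y e : ℤ} (h : Squarefree (x * y)) (hx : e ∣ x)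
    (hy : e ∣ y) : IsUnit e :=
  h e (mul_dvd_mul hx hy)

theorem isIntegralCoord_mk (A B C D : ℤ) :
    IsIntegralCoord ((A : ℚ), (B : ℚ), (C / 2 : ℚ), (C / 2 + D : ℚ)) :=
  ⟨A, B, C, D, rfl⟩

theorem eq_one_or_eq_one_of_hasGenerator (hd : 0 < d) (hm₁ : 0 < m₁)
    (hsq : Squarefree (d * m₁)) (hodd : d % 2 = 1) (hadd : (d + m₁) % 4 = 0)
    (hgen : HasGenerator fun p q r w y =>
      (p * y.1, q * y.2.1, r * y.2.2.1 - w * m₁ * y.2.2.2, r * y.2.2.2 + w * d * y.2.2.1)) :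
    d = 1 ∨ m₁ = 1 := by
  obtain ⟨_, ⟨A, B, X, D, rfl⟩, hgen⟩ := hgen
  obtain ⟨e, he⟩ : ∃ e, d + m₁ = 4 * e := ⟨(d + m₁) / 4, by omega⟩
  have norm : ∀ A' B' C' D' : ℤ, ∃ N : ℤ, (d * C' ^ 2 + m₁ * (C' + 2 * D') ^ 2) =
      N * (d * X ^ 2 + m₁ * (X + 2 * D) ^ 2) := by
    intro A' B' C' D'
    obtain ⟨p, q, r, w, hz, hxy⟩ := hgen _ (isIntegralCoord_mk A' B' C' D')
    -- The images of `b` and `(b + c)/2` express `r`, `w d`, `w m₁` through integers, so that the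
    -- determinant `r² + w² d m₁` is an integer.
    obtain ⟨_, _, R, S, h1⟩ := hz _ (isIntegralCoord_mk 0 0 2 (-1))
    obtain ⟨_, _, _, U, h2⟩ := hz _ (isIntegralCoord_mk 0 0 1 0)
    simp only [Prod.mk.injEq] at hxy h1 h2
    obtain ⟨-, -, h3, h4⟩ := h1
    obtain ⟨-, -, h5, h6⟩ := h2
    obtain ⟨-, -, h7, h8⟩ := hxy
    push_cast at h3 h4 h5 h6
    have hr : r = R / 2 := by linarith
    have hwd : w * d = R / 2 + S := by linarith
    have hwm : w * m₁ = 2 * U - (R / 2 + S) := by linarith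
    refine ⟨R * U + 2 * S * U - R * S - S ^ 2, ?_⟩
    have hN : r ^ 2 + (w * d) * (w * m₁) = R * U + 2 * S * U - R * S - S ^ 2 := by
      rw [hr, hwd, hwm]; ring
    have key : ((d * C' ^ 2 + m₁ * (C' + 2 * D') ^ 2 : ℤ) : ℚ) =
        ((R * U + 2 * S * U - R * S - S ^ 2) * (d * X ^ 2 + m₁ * (X + 2 * D) ^ 2) : ℤ) := by
      push_cast
      rw [← hN, show (C' : ℚ) + 2 * D' = 2 * (C' / 2 + D') by ring, ← h8,
        show (C' : ℚ) = 2 * (C' / 2) by ring, ← h7]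
      ring
    exact_mod_cast key
  -- At `b` and `c` the form takes the values `4d` and `4m₁`, while at any lattice point it is
  -- divisible by `4`.
  obtain ⟨N, hN⟩ := norm 0 0 2 (-1)
  obtain ⟨N', hN'⟩ := norm 0 0 0 1
  set Q := e * X ^ 2 + m₁ * (X * D + D ^ 2) with hQ
  have hQ4 : d * X ^ 2 + m₁ * (X + 2 * D) ^ 2 = 4 * Q := by rw [hQ]; linear_combination X ^ 2 * he
  rw [hQ4] at hN hN'
  have hu : IsUnit Q := isUnit_of_dvd_of_squarefree_mul hsq ⟨N, by linarith⟩ ⟨N', by linarith⟩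
  have hQ0 : 0 ≤ Q := by
    have : 0 ≤ 4 * Q := hQ4 ▸ by positivity
    linarith
  have hQ1 : Q = 1 := by
    rcases Int.isUnit_iff.1 hu with h | h <;> omega
  rw [hQ1] at hQ4
  by_contra! hne
  -- Both are odd and different from `1`. Then `d X² + m₁ Y² = 4` leaves only `X, Y ∈ {-1, 0, 1}` of
  -- equal parity, with value `0` or at least `6`.
  have hd3 : 3 ≤ d := by omega
  have hm3 : 3 ≤ m₁ := by omega
  set Y := X + 2 * D with hY
  have hX : X ^ 2 ≤ 1 := by nlinarith [sq_nonneg X, sq_nonneg Y]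
  have hY1 : Y ^ 2 ≤ 1 := by nlinarith [sq_nonneg X, sq_nonneg Y]
  obtain ⟨x1, x2⟩ := abs_le.1 (sq_le_one_iff_abs_le_one X |>.1 hX)
  obtain ⟨y1, y2⟩ := abs_le.1 (sq_le_one_iff_abs_le_one Y |>.1 hY1)
  clear_value Y
  interval_cases X <;> interval_cases Y <;> omega

theorem eq_two_of_hasGenerator (hd : 0 < d) (hn₁ : 0 < n₁) (hsq : Squarefree (d * n₁))
    (hn : n₁ % 4 = 2)
    (hgen : HasGenerator fun p q r w y =>
      (p * y.1, r * y.2.1 - w * n₁ * y.2.2.2, q * y.2.2.1, r * y.2.2.2 + w * d * y.2.1)) :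
    n₁ = 2 := by
  obtain ⟨_, ⟨A, B, X, D, rfl⟩, hgen⟩ := hgen
  obtain ⟨n₂, rfl⟩ : ∃ n₂, n₁ = 2 * n₂ := ⟨n₁ / 2, by omega⟩
  have norm : ∀ A' B' C' D' : ℤ, ∃ N : ℤ, (2 * d * B' ^ 2 + n₂ * (C' + 2 * D') ^ 2) =
      N * (2 * d * B ^ 2 + n₂ * (X + 2 * D) ^ 2) := by
    intro A' B' C' D'
    obtain ⟨p, q, r, w, hz, hxy⟩ := hgen _ (isIntegralCoord_mk A' B' C' D')
    -- The test vectors are `a` and `(b + c)/2`; the form takes the values `2d` and `n₂` there.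
    obtain ⟨_, R, S, U, h1⟩ := hz _ (isIntegralCoord_mk 0 1 0 0)
    obtain ⟨_, V, _, _, h2⟩ := hz _ (isIntegralCoord_mk 0 0 1 0)
    simp only [Prod.mk.injEq] at hxy h1 h2
    obtain ⟨-, h3, h3', h4⟩ := h1
    obtain ⟨-, h5, -, -⟩ := h2
    obtain ⟨-, h7, -, h8⟩ := hxy
    push_cast at h3 h3' h4 h5 h7
    have hr : r = R := by linarith
    have hwd : w * d = U := by linarith
    have hwn : w * n₂ = -V := by linarith
    refine ⟨R ^ 2 - 2 * U * V, ?_⟩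
    have hN : r ^ 2 + 2 * (w * d) * (w * n₂) = R ^ 2 - 2 * U * V := by
      rw [hr, hwd, hwn]; ring
    have key : ((2 * d * B' ^ 2 + n₂ * (C' + 2 * D') ^ 2 : ℤ) : ℚ) =
        ((R ^ 2 - 2 * U * V) * (2 * d * B ^ 2 + n₂ * (X + 2 * D) ^ 2) : ℤ) := by
      push_cast
      rw [← hN, show (C' : ℚ) + 2 * D' = 2 * (C' / 2 + D') by ring, ← h8, ← h7]
      ring
    exact_mod_cast key
  obtain ⟨N, hN⟩ := norm 0 1 0 0
  obtain ⟨N', hN'⟩ := norm 0 0 1 0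
  set Q := 2 * d * B ^ 2 + n₂ * (X + 2 * D) ^ 2 with hQ
  have hu : IsUnit Q := isUnit_of_dvd_of_squarefree_mul (x := 2 * d) (y := n₂)
    (by rwa [mul_assoc, mul_left_comm]) ⟨N, by linarith⟩ ⟨N', by linarith⟩
  have hn0 : 0 < n₂ := by omega
  have hQ0 : 0 ≤ Q := by positivity
  have hQ1 : Q = 1 := by
    rcases Int.isUnit_iff.1 hu with h | h <;> omega
  have hB : B ^ 2 = 0 := by
    by_contra hB
    have : 1 ≤ B ^ 2 := by have := sq_nonneg B; omega
    have h0 : 0 ≤ n₂ * (X + 2 * D) ^ 2 := by positivity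
    nlinarith
  rw [hB, mul_zero, zero_add, hQ1] at hQ
  have := Int.eq_one_or_neg_one_of_mul_eq_one hQ.symm
  omega

theorem hasGenerator_of_d_eq_one (hm : m₁ % 4 = 3) :
    HasGenerator fun p q r w y => (p * y.1, q * y.2.1, r * y.2.2.1 - w * m₁ * y.2.2.2,
      r * y.2.2.2 + w * (1 : ℤ) * y.2.2.1) := by
  obtain ⟨k, rfl⟩ : ∃ k, m₁ = 4 * k + 3 := ⟨m₁ / 4, by omega⟩
  -- The generator is `1 + a + b`. Here `J² = -m₁ ≡ 1` mod `4`, and the lattice in the plane is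
  -- `ℤ[(1 + J)/2] b`.
  refine ⟨_, isIntegralCoord_mk 1 1 2 (-1), ?_⟩
  rintro _ ⟨A, B, C, D, rfl⟩
  refine ⟨A, B, C / 2, C / 2 + D, ?_, ?_⟩
  · rintro _ ⟨A', B', C', D', rfl⟩
    refine ⟨A * A', B * B',
      -(2 * k + 1) * C * C' - (4 * k + 3) * (C * D' + D * C' + 2 * D * D'),
      (k + 1) * C * C' + (2 * k + 2) * (C * D' + D * C') + (4 * k + 3) * D * D', ?_⟩
    simp only [Prod.mk.injEq]
    refine ⟨?_, ?_, ?_, ?_⟩ <;> push_cast <;> ring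
  · simp only [Prod.mk.injEq]
    refine ⟨?_, ?_, ?_, ?_⟩ <;> push_cast <;> ring

theorem hasGenerator_of_m₁_eq_one (hd : d % 4 = 3) :
    HasGenerator fun p q r w y => (p * y.1, q * y.2.1, r * y.2.2.1 - w * (1 : ℤ) * y.2.2.2,
      r * y.2.2.2 + w * d * y.2.2.1) := by
  obtain ⟨k, rfl⟩ : ∃ k, d = 4 * k + 3 := ⟨d / 4, by omega⟩
  -- The generator is `1 + a + c`. Now `J c = -b` and `J² = -d`, and the lattice in the plane is
  -- `ℤ[(1 + J)/2] c`.
  refine ⟨_, isIntegralCoord_mk 1 1 0 1, ?_⟩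
  rintro _ ⟨A, B, C, D, rfl⟩
  refine ⟨A, B, C / 2 + D, -(C / 2), ?_, ?_⟩
  · rintro _ ⟨A', B', C', D', rfl⟩
    refine ⟨A * A', B * B', C * C' + D * C' + C * D', -(k + 1) * C * C' + D * D', ?_⟩
    simp only [Prod.mk.injEq]
    refine ⟨?_, ?_, ?_, ?_⟩ <;> push_cast <;> ring
  · simp only [Prod.mk.injEq]
    refine ⟨?_, ?_, ?_, ?_⟩ <;> push_cast <;> ring

theorem hasGenerator_swap (d : ℤ) :
    HasGenerator fun p q r w y => (p * y.1, r * y.2.1 - w * (2 : ℤ) * y.2.2.2, q * y.2.2.1,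
      r * y.2.2.2 + w * d * y.2.1) := by
  -- The generator is `1 + (b + c)/2`, whose second half couples the eigenline of `b` to the plane
  -- of `a, c`; accordingly `q ≡ r` mod `2`.
  refine ⟨_, isIntegralCoord_mk 1 0 1 0, ?_⟩
  rintro _ ⟨A, B, C, D, rfl⟩
  refine ⟨A, C, C + 2 * D, -B, ?_, ?_⟩
  · rintro _ ⟨A', B', C', D', rfl⟩
    refine ⟨A * A', (C + 2 * D) * B' + B * (C' + 2 * D'), C * C',
      C * D' + D * C' + 2 * D * D' - d * B * B', ?_⟩
    simp only [Prod.mk.injEq]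
    refine ⟨?_, ?_, ?_, ?_⟩ <;> push_cast <;> ring
  · simp only [Prod.mk.injEq]
    refine ⟨?_, ?_, ?_, ?_⟩ <;> push_cast <;> ring

theorem hasGenerator_mul (hd : d ≠ 0) (m₁ : ℤ) :
    HasGenerator fun p q r w y => (p * y.1, r * y.2.1 + w * d * (2 : ℤ) * y.2.2.1,
      r * y.2.2.1 - w * d * m₁ * y.2.1, q * y.2.2.2) := by
  have hd' : (d : ℚ) ≠ 0 := by exact_mod_cast hd
  refine ⟨_, isIntegralCoord_mk 1 0 1 0, ?_⟩
  rintro _ ⟨A, B, C, D, rfl⟩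
  -- Here `J² = -(a b)² = -d² m₁ n₁`, so `J / d` is the natural operator and `w` may have
  -- denominator `d`.
  refine ⟨A, C + 2 * D, C, B / d, ?_, ?_⟩ <;> simp only [div_mul_cancel₀ (B : ℚ) hd']
  · rintro _ ⟨A', B', C', D', rfl⟩
    refine ⟨A * A', C * B' + B * C', C * C' - 2 * B * m₁ * B',
      C * D' + D * C' + 2 * D * D' + B * m₁ * B', ?_⟩
    simp only [Prod.mk.injEq]
    refine ⟨?_, ?_, ?_, ?_⟩ <;> push_cast <;> ring
  · simp only [Prod.mk.injEq]
    refine ⟨?_, ?_, ?_, ?_⟩ <;> push_cast <;> ring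

end Arithmetic

/-! ### The freeness criterion in terms of `d`, `m₁`, `n₁` -/

namespace IsBiquadraticInt

variable {L : Type*} [Field L] [NumberField L] {σ τ : L ≃ₐ[ℚ] L} {a b c : L} {d m₁ n₁ : ℤ}

theorem forall_isFree_iff (h : IsBiquadraticInt σ τ a b c d m₁ n₁) :
    (∀ i : Fin 3, IsFreeOverAssocOrder (nonClassical σ τ i)) ↔ n₁ = 2 ∧ (d = 1 ∨ m₁ = 1) := by
  have hall : (∀ i : Fin 3, IsFreeOverAssocOrder (nonClassical σ τ i)) ↔
      IsFreeOverAssocOrder (permGroup σ τ) ∧ IsFreeOverAssocOrder (permGroup τ σ) ∧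
        IsFreeOverAssocOrder (permGroup σ (σ * τ)) := by
    simp [Fin.forall_fin_succ, nonClassical]
  rw [hall, h.isFree_permGroup_iff, h.isFree_permGroup_swap_iff, h.isFree_permGroup_mul_iff]
  constructor
  · rintro ⟨h1, h2, -⟩
    exact ⟨eq_two_of_hasGenerator h.d_pos h.n₁_pos h.squarefree_dn h.n₁_mod h2,
      eq_one_or_eq_one_of_hasGenerator h.d_pos h.m₁_pos h.squarefree_dm h.odd_d h.d_add_m₁ h1⟩
  · rintro ⟨rfl, hdm⟩
    refine ⟨?_, hasGenerator_swap d, hasGenerator_mul h.d_pos.ne' m₁⟩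
    have hmod := h.dm_mod
    rcases hdm with rfl | rfl
    · exact hasGenerator_of_d_eq_one (by simpa using hmod)
    · exact hasGenerator_of_m₁_eq_one (by simpa using hmod)

end IsBiquadraticInt

/-! ### Fields generated by two square roots -/

theorem exists_coord_of_adjoin_eq_top {L : Type*} [Field L] [NumberField L] {a b : L} {M P : ℚ}
    (ha : a ^ 2 = M) (hb : b ^ 2 = P) (hL : IntermediateField.adjoin ℚ {a, b} = ⊤) (x : L) :
    ∃ y₀ y₁ y₂ y₃ : ℚ, x = y₀ + y₁ * a + y₂ * b + y₃ * (a * b) := by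
  have hx : x ∈ Algebra.adjoin ℚ ({a, b} : Set L) := by
    rw [← IntermediateField.adjoin_toSubalgebra_of_isAlgebraic, hL]
    · trivial
    · exact fun y _ => Algebra.IsAlgebraic.isAlgebraic y
  induction hx using Algebra.adjoin_induction with
  | mem y hy =>
    rcases hy with rfl | rfl
    · exact ⟨0, 1, 0, 0, by simp⟩
    · exact ⟨0, 0, 1, 0, by simp⟩
  | algebraMap r => exact ⟨r, 0, 0, 0, by simp⟩
  | add y z _ _ hy hz =>
    obtain ⟨y₀, y₁, y₂, y₃, rfl⟩ := hy
    obtain ⟨z₀, z₁, z₂, z₃, rfl⟩ := hz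
    exact ⟨y₀ + z₀, y₁ + z₁, y₂ + z₂, y₃ + z₃, by push_cast; ring⟩
  | mul y z _ _ hy hz =>
    obtain ⟨y₀, y₁, y₂, y₃, rfl⟩ := hy
    obtain ⟨z₀, z₁, z₂, z₃, rfl⟩ := hz
    refine ⟨y₀ * z₀ + M * (y₁ * z₁) + P * (y₂ * z₂) + M * P * (y₃ * z₃),
      y₀ * z₁ + y₁ * z₀ + P * (y₂ * z₃ + y₃ * z₂),
      y₀ * z₂ + y₂ * z₀ + M * (y₁ * z₃ + y₃ * z₁),
      y₀ * z₃ + y₃ * z₀ + y₁ * z₂ + y₂ * z₁, ?_⟩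
    push_cast
    rw [← ha, ← hb]
    ring

theorem pos_of_sq_eq {L : Type*} [Field L] [NumberField L] [NumberField.IsTotallyReal L]
    {x : L} {k : ℤ} (hk : k ≠ 0) (hx : x ^ 2 = k) : 0 < k := by
  let v : NumberField.InfinitePlace L := Classical.arbitrary _
  let φ := NumberField.InfinitePlace.embedding_of_isReal
    (NumberField.IsTotallyReal.isReal v)
  have h := congrArg φ hx
  rw [map_pow, map_intCast] at h
  have : (0 : ℝ) ≤ k := h ▸ sq_nonneg _
  have : 0 ≤ k := by exact_mod_cast this
  omega

theorem adjoin_eq_top_of_mem {L : Type*} [Field L] [NumberField L] {a b c : L}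
    (hL : IntermediateField.adjoin ℚ {a, b} = ⊤)
    (hb : b ∈ IntermediateField.adjoin ℚ ({a, c} : Set L)) :
    IntermediateField.adjoin ℚ {a, c} = ⊤ := by
  rw [eq_top_iff, ← hL, IntermediateField.adjoin_le_iff]
  rintro x (rfl | rfl)
  · exact IntermediateField.subset_adjoin _ _ (by simp)
  · exact hb

theorem exists_isBiquadraticInt {L : Type*} [Field L] [NumberField L]
    [NumberField.IsTotallyReal L] (m n : ℤ) (hm : Squarefree m) (hn : Squarefree n)
    (hm4 : m ≡ 3 [ZMOD 4]) (hn4 : n ≡ 2 [ZMOD 4]) (a b : L) (ha : a ^ 2 = (m : L))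
    (hb : b ^ 2 = (n : L)) (hL : IntermediateField.adjoin ℚ {a, b} = ⊤) (σ τ : L ≃ₐ[ℚ] L)
    (hσa : σ a = -a) (hσb : σ b = b) (hτa : τ a = a) (hτb : τ b = -b) :
    ∃ (c : L) (d m₁ n₁ : ℤ), IsBiquadraticInt σ τ a b c d m₁ n₁ := by
  have hm0 : 0 < m := pos_of_sq_eq hm.ne_zero ha
  have hn0 : 0 < n := pos_of_sq_eq hn.ne_zero hb
  have hm4 : m % 4 = 3 := hm4
  have hn4 : n % 4 = 2 := hn4
  obtain ⟨m₁, hm₁⟩ : (m.gcd n : ℤ) ∣ m := Int.gcd_dvd_left ..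
  obtain ⟨n₁, hn₁⟩ : (m.gcd n : ℤ) ∣ n := Int.gcd_dvd_right ..
  have hd : 0 < (m.gcd n : ℤ) := by exact_mod_cast Int.gcd_pos_of_ne_zero_left _ hm0.ne'
  have hcop : IsCoprime m₁ n₁ := by
    rw [Int.isCoprime_iff_gcd_eq_one]
    have h1 : Int.gcd (m.gcd n * m₁) (m.gcd n * n₁) = m.gcd n := by rw [← hm₁, ← hn₁]
    rw [Int.gcd_mul_left, Int.natAbs_natCast] at h1
    exact Nat.eq_of_mul_eq_mul_left (by exact_mod_cast hd) (by rw [h1, mul_one])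
  generalize (m.gcd n : ℤ) = d at *
  subst hm₁ hn₁
  have hdL : (d : L) ≠ 0 := by exact_mod_cast hd.ne'
  have hsq : ∀ {x : L} {k : ℤ}, 0 < k → x ^ 2 = k → x ≠ 0 := by
    rintro x k hk hx rfl
    have : (k : L) ≠ 0 := by exact_mod_cast hk.ne'
    exact this (by rw [← hx]; simp)
  refine ⟨a * b / d, d, m₁, n₁, ?_⟩
  exact
    { isBiquadratic :=
        { s_left := hσa
          s_right := hσb
          t_left := hτa
          t_right := hτb
          left_ne_zero := hsq hm0 ha
          right_ne_zero := hsq hn0 hb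
          left_sq := by rw [ha]; push_cast; rfl
          right_sq := by rw [hb]; push_cast; rfl
          exists_coord := exists_coord_of_adjoin_eq_top (M := d * m₁) (P := d * n₁)
            (by rw [ha]; push_cast; rfl) (by rw [hb]; push_cast; rfl) hL }
      d_mul_c := mul_div_cancel₀ _ hdL
      d_pos := hd
      m₁_pos := (mul_pos_iff_of_pos_left hd).1 hm0
      n₁_pos := (mul_pos_iff_of_pos_left hd).1 hn0
      squarefree_dm := hm
      squarefree_dn := hn
      squarefree_mn := by
        rw [squarefree_mul_iff]
        exact ⟨hcop.isRelPrime, hm.of_mul_right, hn.of_mul_right⟩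
      dm_mod := hm4
      -- `d` divides the odd `m`, so `n₁` carries exactly the single factor `2` of `n`.
      n₁_mod := by
        have h1 : d % 2 = 1 := by
          rcases Int.even_or_odd' d with ⟨k, hk | hk⟩
          · rw [hk, mul_assoc] at hm4; omega
          · omega
        obtain ⟨k, rfl⟩ : ∃ k, d = 2 * k + 1 := ⟨d / 2, by omega⟩
        have h2 : n₁ % 2 = 0 := by
          rcases Int.even_or_odd' n₁ with ⟨l, rfl | rfl⟩
          · omega
          · ring_nf at hn4; omega
        obtain ⟨l, rfl⟩ : ∃ l, n₁ = 2 * l := ⟨n₁ / 2, by omega⟩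
        rcases Int.even_or_odd' l with ⟨j, rfl | rfl⟩ <;> ring_nf at hn4 <;> omega }

/-! ### Square roots of `2` in `L` -/

namespace IsBiquadraticInt

variable {L : Type*} [Field L] [NumberField L] {σ τ : L ≃ₐ[ℚ] L} {a b c : L} {d m₁ n₁ : ℤ}

theorem exists_sq_eq_two_iff (h : IsBiquadraticInt σ τ a b c d m₁ n₁)
    (hL : IntermediateField.adjoin ℚ {a, b} = ⊤) :
    (∃ e : L, e ^ 2 = 2 ∧ IntermediateField.adjoin ℚ {a, e} = ⊤) ↔
      n₁ = 2 ∧ (d = 1 ∨ m₁ = 1) := by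
  have hd := h.d_pos
  have hm := h.m₁_pos
  have hn := h.n₁_pos
  have hmod := h.n₁_mod
  have of_dvd : ∀ {k x : ℤ}, 0 < k → x ^ 2 * (k * n₁) = 2 → k = 1 ∧ n₁ = 2 := by
    intro k x hk hx
    obtain ⟨l, rfl⟩ : ∃ l, n₁ = 2 * l := ⟨n₁ / 2, by omega⟩
    have h1 : k * (x ^ 2 * l) = 1 := by linarith
    have h2 : l * (x ^ 2 * k) = 1 := by linarith
    rcases Int.eq_one_or_neg_one_of_mul_eq_one h1 with h1 | h1 <;>
      rcases Int.eq_one_or_neg_one_of_mul_eq_one h2 with h2 | h2 <;> omega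
  constructor
  · rintro ⟨e, he, -⟩
    have hint : IsIntegral ℤ e := isIntegral_of_sq (A := 2) (by rw [he]; norm_num)
    have hsσ : σ e = e ∨ σ e = -e := by
      rw [← sq_eq_sq_iff_eq_or_eq_neg, ← map_pow, he, map_ofNat]
    have hsτ : τ e = e ∨ τ e = -e := by
      rw [← sq_eq_sq_iff_eq_or_eq_neg, ← map_pow, he, map_ofNat]
    obtain ⟨y, rfl⟩ := h.ofCoord_surj e
    obtain ⟨A, B, C, D, rfl⟩ := (h.isIntegral_iff y).1 hint
    have eσ : σ (ofCoord a b c ((A : ℚ), (B : ℚ), (C / 2 : ℚ), (C / 2 + D : ℚ))) =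
        ofCoord a b c ((A : ℚ), (-B : ℚ), (C / 2 : ℚ), (-(C / 2 + D) : ℚ)) := by
      simp only [ofCoord, map_add, map_mul, map_ratCast, h.isBiquadratic.s_left,
        h.isBiquadratic.s_right, h.σ_c]
      push_cast; ring
    have eτ : τ (ofCoord a b c ((A : ℚ), (B : ℚ), (C / 2 : ℚ), (C / 2 + D : ℚ))) =
        ofCoord a b c ((A : ℚ), (B : ℚ), (-(C / 2) : ℚ), (-(C / 2 + D) : ℚ)) := by
      simp only [ofCoord, map_add, map_mul, map_ratCast, h.isBiquadratic.t_left,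
        h.isBiquadratic.t_right, h.τ_c]
      push_cast; ring
    have eneg : -ofCoord a b c ((A : ℚ), (B : ℚ), (C / 2 : ℚ), (C / 2 + D : ℚ)) =
        ofCoord a b c ((-A : ℚ), (-B : ℚ), (-(C / 2) : ℚ), (-(C / 2 + D) : ℚ)) := by
      simp only [ofCoord]
      push_cast; ring
    have no_sq : ∀ x : ℤ, x ^ 2 ≠ 2 := by
      intro x hx
      have h1 : x ≤ 1 := by nlinarith
      have h2 : -1 ≤ x := by nlinarith
      interval_cases x <;> omega
    rw [eσ, eneg] at hsσ
    rw [eτ, eneg] at hsτ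
    -- The signs of `σ` and `τ` on `e` decide whether `e` is an integer multiple of `1`, `b`, `a` or
    -- `c`, in this order of cases. The first and third are impossible, since `2` is not a square
    -- and `d m₁ ≥ 3` cannot divide it.
    rcases hsσ with hsσ | hsσ <;> rcases hsτ with hsτ | hsτ <;>
      have h1 := h.ofCoord_inj hsσ <;> have h2 := h.ofCoord_inj hsτ <;>
      simp only [Prod.mk.injEq] at h1 h2
    · have hB : (B : ℚ) = 0 := by linarith
      have hC : (C / 2 : ℚ) = 0 := by linarith
      have hD : (D : ℚ) = 0 := by linarith
      simp only [ofCoord, hB, hC, hD] at he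
      exact absurd (by simpa using he : (A : L) ^ 2 = 2) (by exact_mod_cast no_sq A)
    · have hA : (A : ℚ) = 0 := by linarith
      have hB : (B : ℚ) = 0 := by linarith
      have hC : (C / 2 : ℚ) = (-D : ℤ) := by push_cast; linarith
      simp only [ofCoord, hA, hB, hC] at he
      have h3 : ((D ^ 2 * (d * n₁) : ℤ) : L) = (2 : ℤ) := by
        push_cast
        rw [← h.b_sq]
        push_cast at he
        linear_combination he
      obtain ⟨h4, h5⟩ := of_dvd hd (by exact_mod_cast h3)
      exact ⟨h5, Or.inl h4⟩
    · have hA : (A : ℚ) = 0 := by linarith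
      have hC : (C / 2 : ℚ) = 0 := by linarith
      have hD : (D : ℚ) = 0 := by linarith
      simp only [ofCoord, hA, hC, hD] at he
      have h3 : ((B ^ 2 * (d * m₁) : ℤ) : L) = (2 : ℤ) := by
        push_cast
        rw [← h.a_sq]
        push_cast at he
        linear_combination he
      have h4 : B ^ 2 * (d * m₁) = 2 := by exact_mod_cast h3
      have h5 := h.dm_mod
      have h6 : d * m₁ ∣ 2 := ⟨B ^ 2, by linarith⟩
      have h7 := Int.le_of_dvd (by norm_num) h6
      have h8 := mul_pos hd hm
      omega
    · have hA : (A : ℚ) = 0 := by linarith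
      have hB : (B : ℚ) = 0 := by linarith
      have hC : (C / 2 : ℚ) = 0 := by linarith
      simp only [ofCoord, hA, hB, hC, zero_add] at he
      have h3 : ((D ^ 2 * (m₁ * n₁) : ℤ) : L) = (2 : ℤ) := by
        push_cast
        rw [← h.c_sq]
        push_cast at he
        linear_combination he
      obtain ⟨h4, h5⟩ := of_dvd hm (by exact_mod_cast h3)
      exact ⟨h5, Or.inr h4⟩
  · rintro ⟨rfl, rfl | rfl⟩
    · exact ⟨b, by rw [h.b_sq]; norm_num, hL⟩
    · refine ⟨c, by rw [h.c_sq]; norm_num, adjoin_eq_top_of_mem hL ?_⟩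
      have hb : b = a * c := by rw [h.a_mul_c]; simp
      rw [hb]
      exact mul_mem (IntermediateField.subset_adjoin _ _ (by simp))
        (IntermediateField.subset_adjoin _ _ (by simp))

end IsBiquadraticInt
end HopfGalois
end

theorem mainTheorem6 {L : Type*} [Field L] [NumberField L] [NumberField.IsTotallyReal L]
    (m n : ℤ) (hm : Squarefree m) (hn : Squarefree n)
    (hm4 : m ≡ 3 [ZMOD 4]) (hn4 : n ≡ 2 [ZMOD 4])
    (a b : L) (ha : a ^ 2 = (m : L)) (hb : b ^ 2 = (n : L))
    (hL : IntermediateField.adjoin ℚ {a, b} = ⊤)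
    (σ τ : L ≃ₐ[ℚ] L) (hσa : σ a = -a) (hσb : σ b = b) (hτa : τ a = a) (hτb : τ b = -b) :
    (∀ i : Fin 3, HopfGalois.IsFreeOverAssocOrder (HopfGalois.nonClassical σ τ i)) ↔
      ∃ c : L, c ^ 2 = 2 ∧ IntermediateField.adjoin ℚ {a, c} = ⊤ := by
  obtain ⟨c, d, m₁, n₁, h⟩ := HopfGalois.exists_isBiquadraticInt m n hm hn hm4 hn4 a b ha hb hL
    σ τ hσa hσb hτa hτb
  rw [h.forall_isFree_iff, h.exists_sq_eq_two_iff hL]
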